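/- **Setting.** Let $\Delta$ be a finite or countably infinite alphabet, $\Delta^*$ the set of finite words over $\Delta$, and $(\Omega,\Sigma,P)$ a probability space. Let $J\subset\mathbb R^d$ be compact with $J=\overline{\operatorname{Int}J}$ and $\operatorname{diam}J=1$. Let $J_\sigma(\omega)$ ($\sigma\in\Delta^*$, $\omega\in\Omega$) be compact, possibly empty, subsets of $\mathbb R^d$; put $l_\sigma=\operatorname{diam}J_\sigma$, $T_{\sigma*i}=l_{\sigma*i}/l_\sigma$ and $$K(\omega)=\bigcap_{k\ge1}\ \bigcup_{|\sigma|=k}J_\sigma(\omega).$$ Assume that this is a random recursive construction: 1. $J_\emptyset=J$ a.s.; 2. each map $\omega\mapsto J_\sigma(\omega)$ is measurable for the Vietoris topology; 3. each nonempty $J_\sigma(\omega)$ is the image of $J$ under a similarity map of $\mathbb R^d$; 4. a.s., for all $\sigma$ and $i$: $J_{\sigma*i}\subseteq J_\sigma$, and $J_{\sigma*i}\ne J_\sigma$ if $J_\sigma\neq\emptyset$ (so an empty cell has only empty children); 5. (random open set condition) for distinct words $\sigma,\tau$ of equal length, $\operatorname{Int}J_\sigma\cap\operatorname{Int}J_\tau=\emptyset$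 a.s.; 6. the vectors of reduction ratios of nonempty cells are i.i.d.: after enlarging the probability space, if necessary, by an independent factor, there are i.i.d. random vectors $V_\sigma\in\mathbb R^\Delta$, $\sigma\in\Delta^*$, such that a.s. $(T_{\sigma*i})_{i\in\Delta}=V_\sigma$ for every $\sigma$ with $J_\sigma\ne\emptyset$. Assume also: 7. (pointwise finite) every $x\in J$ a.s. belongs to at most finitely many of the first-level sets $J_i$, $i\in\Delta$; 8. (neighbourhood boundedness) there is $n_0\in\mathbb N$ such that for every $\varepsilon>\operatorname{diam}J$, if $A_1,\dots,A_k$ are similar to $J$, have pairwise disjoint interiors, and $\operatorname{diam}A_i\ge\varepsilon>\operatorname{dist}(J,A_i)$ for all $i$, then $k\le n_0$. **Orbits.** For all $\tau,i,\omega$ with $J_\tau(\omega)\ne\emptyset\neq J_{\tau*i}(\omega)$ let $S^\tau_i$ be a similarity map of $\mathbb R^d$ with $S^\tau_i(J_\tau)=J_{\tau*i}$. For $y\in J_\tau$ let $O_\tau(y,1)=\{S^\tau_i(y): i\in\Delta,\ J_{\tau*i}\cap K\neq\emptyset\}$. Let $N_r(M)$ be the least number of closed balls of radius $r$ that cover $M$,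 and $$\overline{\dim}_BM=\limsup_{r\to0+}\frac{\log N_r(M)}{-\log r},\qquad \underline{\dim}_BM=\liminf_{r\to0+}\frac{\log N_r(M)}{-\log r}$$ (with value $-\infty$ for $M=\emptyset$). For an arbitrary choice of points $x_\tau(\omega)\in J_\tau(\omega)$ (for all $\tau,\omega$ with $J_\tau(\omega)\ne\emptyset$) put $\overline\gamma_\tau=\overline{\dim}_BO_\tau(x_\tau,1)$, $\underline\gamma_\tau=\underline{\dim}_BO_\tau(x_\tau,1)$, $\overline\gamma=\sup_\tau\overline\gamma_\tau$ and $\underline\gamma=\sup_\tau\underline\gamma_\tau$, the suprema being over all $\tau$ with $J_\tau\ne\emptyset$. **Theorem.** (a) Suppose there is a constant $A>0$ such that a.s., for all $\tau\in\Delta^*$, $y\in J_\tau$, $t>0$ and $0<r\le l_\tau$, $$N_r(O_\tau(y,1))\,\mathbf 1_{\{\overline\gamma_\tau<t\}}\le A\,r^{-t}\,l_\tau^{\,t}.$$ Then $\overline{\dim}_BK=\max\{\dim_HK,\overline\gamma\}$ a.s. on $\{K\ne\emptyset\}$. (b) Suppose there is a constant $A>0$ such that a.s., for all $\tau\in\Delta^*$,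 $y\in J_\tau$, $t>0$ and $0<r\le l_\tau$, $$N_r(O_\tau(y,1))\,\mathbf 1_{\{\underline\gamma_\tau<t\}}\le A\,r^{-t}\,l_\tau^{\,t}.$$ Then $\overline{\dim}_BK=\underline{\dim}_BK=\max\{\dim_HK,\underline\gamma\}$ a.s. on $\{K\ne\emptyset\}$. -/

import Mathlib

open MeasureTheory ProbabilityTheory Filter Topology TopologicalSpace

noncomputable section

namespace RandomRecursive

/-- The Euclidean space `ℝ^d`. -/
abbrev Euc (d : ℕ) : Type := EuclideanSpace ℝ (Fin d)

/-! ### Minkowski dimensions -/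

/-- `N_r(A)`: the smallest number of closed balls of radius `r` (with arbitrary centres) needed to
cover `A`. -/
def ballCount {X : Type*} [PseudoEMetricSpace X] (r : ℝ) (A : Set X) : ENNReal :=
  ((Metric.externalCoveringNumber r.toNNReal A : ℕ∞) : ENNReal)

/-- The upper Minkowski dimension `limsup_{r → 0+} log N_r(A) / (- log r)`, an extended real
(the value at `∅` is `-∞`). -/
def upperMinkowskiDim {X : Type*} [PseudoEMetricSpace X] (A : Set X) : EReal :=
  limsup (fun r : ℝ => ENNReal.log (ballCount r A) / ((-Real.log r : ℝ) : EReal)) (𝓝[>] 0)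

/-- The lower Minkowski dimension `liminf_{r → 0+} log N_r(A) / (- log r)`. -/
def lowerMinkowskiDim {X : Type*} [PseudoEMetricSpace X] (A : Set X) : EReal :=
  liminf (fun r : ℝ => ENNReal.log (ballCount r A) / ((-Real.log r : ℝ) : EReal)) (𝓝[>] 0)

/-! ### Similar sets -/

/-- A similarity map of `ℝ^d`, of some ratio `r > 0`. -/
def IsSimilarity {d : ℕ} (f : Euc d → Euc d) : Prop :=
  ∃ r : ℝ, 0 < r ∧ ∀ x y, dist (f x) (f y) = r * dist x y

/-- `A` and `B` are geometrically similar: a similarity map of `ℝ^d` takes `A` onto `B`. -/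
def GeomSimilar {d : ℕ} (A B : Set (Euc d)) : Prop :=
  ∃ f : Euc d → Euc d, IsSimilarity f ∧ f '' A = B

/-- The neighbourhood boundedness property of `J`: there is `n₀` such that for every
`ε > diam J`, at most `n₀` non-overlapping sets `A i` similar to `J` can satisfy
`diam (A i) ≥ ε > dist (J, A i)`. -/
def NeighborhoodBounded {d : ℕ} (J : Set (Euc d)) : Prop :=
  ∃ n₀ : ℕ, ∀ ε : ℝ, Metric.diam J < ε → ∀ (k : ℕ) (A : Fin k → Set (Euc d)),
    (∀ i, GeomSimilar J (A i)) →
    (∀ i j, i ≠ j → Disjoint (interior (A i)) (interior (A j))) →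
    (∀ i, ε ≤ Metric.diam (A i)) →
    (∀ i, ∃ x ∈ J, ∃ y ∈ A i, dist x y < ε) →
    k ≤ n₀

/-! ### Random recursive constructions

Words over the alphabet `Δ` are lists, `σ ++ [i]` is the word `σ` followed by the letter `i`, and a
cell that is absent is the empty compact set. -/

section Construction

variable {d : ℕ} {Δ Ω : Type*}

/-- The size `l_σ(ω) = diam J_σ(ω)` of a cell. -/
def cellDiam (J : List Δ → Ω → Compacts (Euc d)) (σ : List Δ) (ω : Ω) : ℝ :=
  Metric.diam (J σ ω : Set (Euc d))

/-- The vector `T_σ = (T_{σ * i})_i` of reduction ratios at the cell `σ`,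
`T_{σ * i} = diam J_{σ * i} / diam J_σ`. -/
def ratioVector (J : List Δ → Ω → Compacts (Euc d)) (σ : List Δ) (ω : Ω) : Δ → ℝ :=
  fun i => cellDiam J (σ ++ [i]) ω / cellDiam J σ ω

/-- The random limit set `K(ω) = ⋂_{k ≥ 1} ⋃_{|σ| = k} J_σ(ω)`. -/
def limitSet (J : List Δ → Ω → Compacts (Euc d)) (ω : Ω) : Set (Euc d) :=
  ⋂ k : ℕ, ⋂ _ : 1 ≤ k, ⋃ σ : List Δ, ⋃ _ : σ.length = k, (J σ ω : Set (Euc d))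

/-- The vectors of reduction ratios of the nonempty cells are those of an i.i.d. family: there are
i.i.d. random vectors `V_σ`, indexed by all words, such that a.s. `T_σ = V_σ` at every word `σ`
with `J_σ ≠ ∅`. The family may use an independent additional source of randomness
(the second factor), since at the empty cells the construction provides no values. -/
def HasIIDRatios [MeasurableSpace Ω] (P : Measure Ω) (J : List Δ → Ω → Compacts (Euc d)) : Prop :=
  ∃ (Q : Measure (List Δ → Δ → ℝ)) (V : List Δ → Ω × (List Δ → Δ → ℝ) → Δ → ℝ),
    IsProbabilityMeasure Q ∧
    (∀ σ, Measurable (V σ)) ∧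
    iIndepFun V (P.prod Q) ∧
    (∀ σ, IdentDistrib (V σ) (V []) (P.prod Q) (P.prod Q)) ∧
    ∀ᵐ z ∂(P.prod Q), ∀ σ, (J σ z.1 : Set (Euc d)).Nonempty → V σ z = ratioVector J σ z.1

/-- A random recursive construction with seed `J₀` and cells `J σ ω`. -/
structure IsRandomRecursiveConstruction [MeasurableSpace Ω] (P : Measure Ω)
    (J₀ : Compacts (Euc d)) (J : List Δ → Ω → Compacts (Euc d)) : Prop where
  /-- The seed is the closure of its interior. -/
  seed_regular : closure (interior (J₀ : Set (Euc d))) = J₀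
  /-- The seed has diameter one. -/
  seed_diam : Metric.diam (J₀ : Set (Euc d)) = 1
  /-- The root cell is the seed. -/
  root : ∀ᵐ ω ∂P, J [] ω = J₀
  /-- The cells are measurable for the Vietoris topology on compact sets. -/
  measurable_cell : ∀ σ, Measurable[_, borel (Compacts (Euc d))] (J σ)
  /-- Nonempty cells are similar to the seed. -/
  similar : ∀ σ ω, (J σ ω : Set (Euc d)).Nonempty →
    GeomSimilar (J₀ : Set (Euc d)) (J σ ω : Set (Euc d))
  /-- Children are subsets of their parent (in particular empty cells only have empty children),
  and proper ones if the parent is nonempty. -/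
  nested : ∀ᵐ ω ∂P, ∀ σ i, (J (σ ++ [i]) ω : Set (Euc d)) ⊆ J σ ω ∧
    ((J σ ω : Set (Euc d)).Nonempty → J (σ ++ [i]) ω ≠ J σ ω)
  /-- The random open set condition. -/
  open_set : ∀ σ τ : List Δ, σ.length = τ.length → σ ≠ τ →
    ∀ᵐ ω ∂P, interior (J σ ω : Set (Euc d)) ∩ interior (J τ ω : Set (Euc d)) = ∅
  /-- The reduction ratios at the nonempty cells are i.i.d. -/
  iid_ratios : HasIIDRatios P J

/-- The construction is pointwise finite: each point of the seed a.s. belongs to at most finitely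
many first-level cells. -/
def PointwiseFinite [MeasurableSpace Ω] (P : Measure Ω)
    (J₀ : Compacts (Euc d)) (J : List Δ → Ω → Compacts (Euc d)) : Prop :=
  ∀ x ∈ J₀, ∀ᵐ ω ∂P, {i : Δ | x ∈ J [i] ω}.Finite

/-- `S τ i ω` is a similarity map taking `J_τ(ω)` onto its child `J_{τ * i}(ω)`, whenever both cells
are nonempty. -/
def IsSimilaritySystem (J : List Δ → Ω → Compacts (Euc d))
    (S : List Δ → Δ → Ω → Euc d → Euc d) : Prop :=
  ∀ τ i ω, (J τ ω : Set (Euc d)).Nonempty → (J (τ ++ [i]) ω : Set (Euc d)).Nonempty →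
    IsSimilarity (S τ i ω) ∧ S τ i ω '' (J τ ω : Set (Euc d)) = J (τ ++ [i]) ω

/-- `x τ ω` is a point of `J_τ(ω)` whenever this cell is nonempty. -/
def IsBasePoints (J : List Δ → Ω → Compacts (Euc d)) (x : List Δ → Ω → Euc d) : Prop :=
  ∀ τ ω, (J τ ω : Set (Euc d)).Nonempty → x τ ω ∈ J τ ω

/-- The first-level orbit `O_τ(y, 1)` of `y` within `J_τ(ω)`: the images of `y` in those children of
`J_τ(ω)` that meet `K(ω)`. -/
def firstOrbit (J : List Δ → Ω → Compacts (Euc d)) (S : List Δ → Δ → Ω → Euc d → Euc d)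
    (τ : List Δ) (ω : Ω) (y : Euc d) : Set (Euc d) :=
  {z | ∃ i : Δ, ((J (τ ++ [i]) ω : Set (Euc d)) ∩ limitSet J ω).Nonempty ∧ z = S τ i ω y}

/-- The supremum over the nonempty cells `τ` of `D (O_τ(x_τ, 1))`. It is `γ̄` for
`D = upperMinkowskiDim` and `γ̲` for `D = lowerMinkowskiDim`. -/
def orbitDimSup (D : Set (Euc d) → EReal) (J : List Δ → Ω → Compacts (Euc d))
    (S : List Δ → Δ → Ω → Euc d → Euc d) (x : List Δ → Ω → Euc d) (ω : Ω) : EReal :=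
  ⨆ τ : List Δ, ⨆ _ : (J τ ω : Set (Euc d)).Nonempty, D (firstOrbit J S τ ω (x τ ω))

/-- The uniform orbit covering bound, in terms of the dimension `D` of the orbits: for one constant
`A`, a.s. for all cells `τ`, all `y ∈ J_τ`, all `t > 0` with `D (O_τ(x_τ, 1)) < t` and all
`0 < r ≤ l_τ`, one has `N_r(O_τ(y, 1)) ≤ A r^{-t} l_τ^t`. -/
def UniformOrbitBound [MeasurableSpace Ω] (P : Measure Ω) (D : Set (Euc d) → EReal)
    (J : List Δ → Ω → Compacts (Euc d)) (S : List Δ → Δ → Ω → Euc d → Euc d)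
    (x : List Δ → Ω → Euc d) : Prop :=
  ∃ A : ℝ, 0 < A ∧ ∀ᵐ ω ∂P, ∀ τ : List Δ, ∀ y ∈ J τ ω, ∀ t : ℝ, 0 < t →
    D (firstOrbit J S τ ω (x τ ω)) < t →
    ∀ r : ℝ, 0 < r → r ≤ cellDiam J τ ω →
      ballCount r (firstOrbit J S τ ω y) ≤ ENNReal.ofReal (A * r ^ (-t) * cellDiam J τ ω ^ t)

end Construction

end RandomRecursive

end

open MeasureTheory ProbabilityTheory Filter Topology TopologicalSpace

noncomputable section

namespace RandomRecursive

/-! ### Covering numbers and Minkowski dimensions -/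

section Minkowski

variable {X Y : Type*} [PseudoMetricSpace X] [PseudoMetricSpace Y]

/-! Two lower bounds for the dimension of K meet one upper bound.

Lower bounds. `dimH_le_lowerMinkowskiDim` is general. For an orbit O_τ, every orbit point lies in a
child cell meeting K. If the child is small, its point is close to the centre of a ball covering K.
The large children near one such centre are at most n₀ by neighbourhood boundedness, since
incomparable cells have disjoint interiors. Hence N_{3r}(O_τ) ≤ (n₀ + 1) N_r(K)
(`ballCount_firstOrbit_le`), which bounds the upper and the lower dimension of O_τ by that of K.

Upper bound. Descend towards a point of K until the cell is smaller than r: the parent τ still has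
l_τ ≥ r, and the point is r-close to O_τ. So N_{2r}(K) ≤ Σ_{l_τ ≥ r} N_r(O_τ) ≤ A r^{-t} Σ_τ l_τ^t,
and it remains to see that Σ_τ l_τ^t < ∞ for every rational t > dim_H K, almost surely on K ≠ ∅
(`ae_tsum_cellDiam_lt_top`).

Let φ(s) = E Σ_i T_i^s. If φ(t) < 1, the expected sum is at most the geometric series Σ φ(t)^k. If
φ(t) ≥ 1, then φ(p) > 1 for 0 < p < t, and this forces dim_H K ≥ p a.s. on K ≠ ∅, so dim_H K ≥ t. To
prove it, keep finitely many letters and ratios in [δ, 1 - δ], with mean still above 1. The net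
content of this tree, the least weight of a cut, has expectation bounded away from 0
(`sum_lintegral_le_one_add`), so its limit is positive with positive probability. A zero-one
argument (`ae_exists_subtree_mem_of_survive`) finds, a.s. on survival, a nonempty cell whose subtree
has positive net content. A cover of K with small Σ r_j^p would yield a cut of too small weight
below that cell (`le_dimH_limitSet_of_netContent_pos`).

The upper bound works for either orbit dimension. With the lower one it closes the chain between
both Minkowski dimensions of K, which is (b). -/

lemma ballCount_le_encard {r : ℝ} {A : Set X} (C : Set X)
    (hC : ∀ a ∈ A, ∃ c ∈ C, dist a c ≤ r) : ballCount r A ≤ ((C.encard : ℕ∞) : ENNReal) := by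
  have : Metric.IsCover r.toNNReal A C := by
    intro a ha
    obtain ⟨c, hc, h⟩ := hC a ha
    refine ⟨c, hc, ?_⟩
    change edist a c ≤ _
    rw [edist_dist]
    exact ENNReal.ofReal_le_ofReal h
  exact ENat.toENNReal_le.2 this.externalCoveringNumber_le_encard

lemma exists_cover_of_ballCount_lt_top {r : ℝ} (hr : 0 ≤ r) {A : Set X}
    (h : ballCount r A < ⊤) :
    ∃ C : Finset X, (∀ a ∈ A, ∃ c ∈ C, dist a c ≤ r) ∧ ballCount r A = (C.card : ENNReal) := by
  have h1 : Metric.externalCoveringNumber r.toNNReal A < ⊤ := by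
    simpa [ballCount] using h
  have : Nonempty {C : Set X // Metric.IsCover r.toNNReal A C} := ⟨⟨A, .refl _ _⟩⟩
  obtain ⟨C, hC⟩ := ENat.exists_eq_iInf
    (fun C : {C : Set X // Metric.IsCover r.toNNReal A C} => (C : Set X).encard)
  have hC' : (C : Set X).encard = Metric.externalCoveringNumber r.toNNReal A := by
    rw [hC, Metric.externalCoveringNumber, iInf_subtype]
  have hfin : (C : Set X).Finite := by
    rw [← Set.encard_lt_top_iff, hC']; exact h1
  refine ⟨hfin.toFinset, ?_, ?_⟩
  · intro a ha
    obtain ⟨c, hc, h⟩ := C.2 ha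
    refine ⟨c, by simpa using hc, ?_⟩
    change edist a c ≤ _ at h
    rw [edist_dist] at h
    exact (ENNReal.ofReal_le_ofReal_iff hr).1 h
  · rw [ballCount, ← hC', hfin.encard_eq_coe_toFinset_card]; simp

lemma one_le_ballCount {r : ℝ} {A : Set X} (hA : A.Nonempty) : 1 ≤ ballCount r A := by
  have := Metric.externalCoveringNumber_pos_iff (ε := r.toNNReal).2 hA
  have h1 := ENat.toENNReal_le.2 (Order.one_le_iff_pos.2 this)
  simpa [ballCount] using h1

lemma neg_log_pos {r : ℝ} (h0 : 0 < r) (h1 : r < 1) : (0 : EReal) < ((-Real.log r : ℝ) : EReal) := by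
  have := Real.log_neg h0 h1
  exact_mod_cast neg_pos.2 this

lemma log_ofReal_rpow_neg {r : ℝ} (h0 : 0 < r) (t : ℝ) :
    ENNReal.log (ENNReal.ofReal (r ^ (-t))) = ((t * (-Real.log r) : ℝ) : EReal) := by
  rw [ENNReal.log_ofReal_of_pos (by positivity), Real.log_rpow h0]
  congr 1; ring

lemma log_div_lt_iff {r : ℝ} (h0 : 0 < r) (h1 : r < 1) (N : ENNReal) (t : ℝ) :
    ENNReal.log N / ((-Real.log r : ℝ) : EReal) < t ↔ N < ENNReal.ofReal (r ^ (-t)) := by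
  rw [EReal.div_lt_iff (neg_log_pos h0 h1) (EReal.coe_ne_top _), ← ENNReal.log_lt_log_iff,
    log_ofReal_rpow_neg h0, EReal.coe_mul]

lemma log_div_le_iff {r : ℝ} (h0 : 0 < r) (h1 : r < 1) (N : ENNReal) (t : ℝ) :
    ENNReal.log N / ((-Real.log r : ℝ) : EReal) ≤ t ↔ N ≤ ENNReal.ofReal (r ^ (-t)) := by
  rw [EReal.div_le_iff_le_mul (neg_log_pos h0 h1) (EReal.coe_ne_top _), ← ENNReal.log_le_log_iff,
    log_ofReal_rpow_neg h0, EReal.coe_mul, mul_comm]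

lemma eventually_mem_Ioo : ∀ᶠ r : ℝ in 𝓝[>] 0, 0 < r ∧ r < 1 :=
  Ioo_mem_nhdsGT one_pos

lemma tendsto_const_mul_nhdsGT {c : ℝ} (hc : 0 < c) :
    Tendsto (fun r : ℝ => c * r) (𝓝[>] 0) (𝓝[>] 0) := by
  refine tendsto_nhdsWithin_iff.2 ⟨?_, ?_⟩
  · have : Tendsto (fun r : ℝ => c * r) (𝓝 0) (𝓝 (c * 0)) := tendsto_id.const_mul c
    rw [mul_zero] at this
    exact this.mono_left nhdsWithin_le_nhds
  · filter_upwards [self_mem_nhdsWithin] with r hr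
    exact mul_pos hc hr

lemma eventually_of_const_mul {c : ℝ} (hc : 0 < c) {p : ℝ → Prop}
    (h : ∀ᶠ r in 𝓝[>] (0 : ℝ), p (c * r)) : ∀ᶠ r in 𝓝[>] (0 : ℝ), p r := by
  have := (tendsto_const_mul_nhdsGT (inv_pos.2 hc)).eventually h
  filter_upwards [this] with r hr
  rwa [mul_inv_cancel_left₀ hc.ne'] at hr

lemma eventually_const_mul_rpow_le {c t t' : ℝ} (hc : 0 < c) (h : t < t') {C : ENNReal}
    (hC : C ≠ ⊤) :
    ∀ᶠ r in 𝓝[>] (0 : ℝ), C * ENNReal.ofReal (r ^ (-t)) ≤ ENNReal.ofReal ((c * r) ^ (-t')) := by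
  have h1 := (tendsto_rpow_neg_nhdsGT_zero (y := t - t') (by linarith)).eventually_ge_atTop
    (C.toReal * c ^ t')
  filter_upwards [h1, eventually_mem_Ioo] with r hr hr0
  obtain ⟨h0, -⟩ := hr0
  rw [← ENNReal.ofReal_toReal hC, ← ENNReal.ofReal_mul ENNReal.toReal_nonneg]
  refine ENNReal.ofReal_le_ofReal ?_
  rw [Real.mul_rpow hc.le h0.le, Real.rpow_neg hc.le]
  have e : r ^ (-t') = r ^ (t - t') * r ^ (-t) := by rw [← Real.rpow_add h0]; congr 1; ring
  rw [e, ← mul_assoc]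
  refine mul_le_mul_of_nonneg_right ?_ (by positivity)
  rw [← div_eq_inv_mul, le_div_iff₀ (by positivity)]
  exact hr

lemma upperMinkowskiDim_le_of_ballCount_le {A : Set X} {c t : ℝ} (hc : 0 < c) {C : ENNReal}
    (hC : C ≠ ⊤) (h : ∀ᶠ r in 𝓝[>] (0 : ℝ), ballCount (c * r) A ≤ C * ENNReal.ofReal (r ^ (-t))) :
    upperMinkowskiDim A ≤ t := by
  refine EReal.le_of_forall_lt_iff_le.1 fun t' ht' => ?_
  have ht' : t < t' := by exact_mod_cast ht'
  refine limsup_le_of_le (by isBoundedDefault) ?_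
  refine eventually_of_const_mul hc ?_
  filter_upwards [h, eventually_const_mul_rpow_le hc ht' hC,
    (tendsto_const_mul_nhdsGT hc).eventually eventually_mem_Ioo] with r h1 h2 h3
  exact (log_div_le_iff h3.1 h3.2 _ _).2 (h1.trans h2)

lemma upperMinkowskiDim_le_of_comparison {A : Set X} {B : Set Y} {c : ℝ} (hc : 0 < c) {C : ENNReal}
    (hC : C ≠ ⊤) (h : ∀ᶠ r in 𝓝[>] (0 : ℝ), ballCount (c * r) A ≤ C * ballCount r B) :
    upperMinkowskiDim A ≤ upperMinkowskiDim B := by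
  refine EReal.le_of_forall_lt_iff_le.1 fun t ht => ?_
  refine upperMinkowskiDim_le_of_ballCount_le hc hC ?_
  filter_upwards [h, eventually_lt_of_limsup_lt ht, eventually_mem_Ioo] with r h1 h2 h3
  refine h1.trans ?_
  gcongr
  exact ((log_div_lt_iff h3.1 h3.2 _ _).1 h2).le

lemma lowerMinkowskiDim_le_of_comparison {A : Set X} {B : Set Y} {c : ℝ} (hc : 0 < c) {C : ENNReal}
    (hC : C ≠ ⊤) (h : ∀ᶠ r in 𝓝[>] (0 : ℝ), ballCount (c * r) A ≤ C * ballCount r B) :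
    lowerMinkowskiDim A ≤ lowerMinkowskiDim B := by
  refine EReal.le_of_forall_lt_iff_le.1 fun t ht => ?_
  refine EReal.le_of_forall_lt_iff_le.1 fun t' ht' => ?_
  have ht' : t < t' := by exact_mod_cast ht'
  refine liminf_le_of_frequently_le ?_ (by isBoundedDefault)
  intro hcon
  have hcon' := (tendsto_const_mul_nhdsGT hc).eventually hcon
  refine frequently_lt_of_liminf_lt (by isBoundedDefault) ht ?_
  filter_upwards [h, hcon', eventually_const_mul_rpow_le hc ht' hC, eventually_mem_Ioo,
    (tendsto_const_mul_nhdsGT hc).eventually eventually_mem_Ioo] with r h1 h2 h3 h4 h5 h6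
  refine h2 ((log_div_le_iff h5.1 h5.2 _ _).2 ((h1.trans ?_).trans h3))
  gcongr
  exact ((log_div_lt_iff h4.1 h4.2 _ _).1 h6).le

lemma lowerMinkowskiDim_le_upperMinkowskiDim (A : Set X) :
    lowerMinkowskiDim A ≤ upperMinkowskiDim A :=
  liminf_le_limsup

end Minkowski

lemma dimH_le_lowerMinkowskiDim {X : Type*} [MetricSpace X] {A : Set X} (hA : A.Nonempty) :
    (dimH A : EReal) ≤ lowerMinkowskiDim A := by
  let _ : MeasurableSpace X := borel X
  have : BorelSpace X := ⟨rfl⟩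
  refine EReal.le_of_forall_lt_iff_le.1 fun t ht => ?_
  have hf := frequently_lt_of_liminf_lt (by isBoundedDefault) ht
  have hf2 : ∃ᶠ r in 𝓝[>] (0 : ℝ), (0 < r ∧ r < 1) ∧ ballCount r A < ENNReal.ofReal (r ^ (-t)) := by
    refine (hf.and_eventually eventually_mem_Ioo).mono fun r hr => ⟨hr.2, ?_⟩
    exact (log_div_lt_iff hr.2.1 hr.2.2 _ _).1 hr.1
  have ht0 : 0 < t := by
    obtain ⟨r, ⟨h0, h1⟩, h2⟩ := hf2.exists
    by_contra hneg
    have h3 : (1 : ENNReal) < ENNReal.ofReal (r ^ (-t)) := (one_le_ballCount hA).trans_lt h2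
    rw [ENNReal.one_lt_ofReal] at h3
    exact absurd h3 (not_lt.2 (Real.rpow_le_one h0.le h1.le (by linarith)))
  refine EReal.le_of_forall_lt_iff_le.1 fun t' ht' => ?_
  have ht' : t < t' := by exact_mod_cast ht'
  have ht'0 : 0 < t' := ht0.trans ht'
  obtain ⟨u, hu, hu2⟩ := exists_seq_forall_of_frequently hf2
  have hfin : ∀ n, ballCount (u n) A < ⊤ := fun n => (hu2 n).2.trans_le le_top
  choose C hC hcard using fun n => exists_cover_of_ballCount_lt_top (hu2 n).1.1.le (hfin n)
  have hu0 : Tendsto u atTop (𝓝 0) := hu.mono_right nhdsWithin_le_nhds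
  have key : μH[t'] A ≤ liminf (fun n => ∑ i : C n,
      Metric.ediam (Metric.closedBall (i : X) (u n)) ^ t') atTop := by
    refine Measure.hausdorffMeasure_le_liminf_sum t' A (fun n => ENNReal.ofReal (2 * u n)) ?_
      (fun n (i : C n) => Metric.closedBall (i : X) (u n)) ?_ ?_
    · have : Tendsto (fun n => ENNReal.ofReal (2 * u n)) atTop (𝓝 (ENNReal.ofReal (2 * 0))) :=
        ENNReal.tendsto_ofReal (hu0.const_mul 2)
      simpa using this
    · refine Eventually.of_forall fun n i => ?_
      rw [ENNReal.ofReal_mul (by norm_num), ← Metric.closedEBall_ofReal (hu2 n).1.1.le]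
      simpa using Metric.ediam_closedEBall_le (x := (i : X)) (r := ENNReal.ofReal (u n))
    · refine Eventually.of_forall fun n a ha => ?_
      obtain ⟨c, hc, h⟩ := hC n a ha
      exact Set.mem_iUnion.2 ⟨⟨c, hc⟩, h⟩
  have hle : μH[t'] A ≠ ⊤ := by
    refine ne_top_of_le_ne_top (b := ENNReal.ofReal (2 ^ t')) ENNReal.ofReal_ne_top (key.trans ?_)
    refine liminf_le_of_frequently_le (Eventually.frequently (Eventually.of_forall fun n => ?_))
      (by isBoundedDefault)
    obtain ⟨⟨h0, h1⟩, h2⟩ := hu2 n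
    calc ∑ i : C n, Metric.ediam (Metric.closedBall (i : X) (u n)) ^ t'
        ≤ ∑ i : C n, ENNReal.ofReal (2 * u n) ^ t' := by
          refine Finset.sum_le_sum fun i _ => ENNReal.rpow_le_rpow ?_ ht'0.le
          rw [ENNReal.ofReal_mul (by norm_num), ← Metric.closedEBall_ofReal h0.le]
          simpa using Metric.ediam_closedEBall_le (x := (i : X)) (r := ENNReal.ofReal (u n))
      _ = ballCount (u n) A * ENNReal.ofReal ((2 * u n) ^ t') := by
          rw [hcard, ENNReal.ofReal_rpow_of_pos (by positivity)]; simp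
      _ ≤ ENNReal.ofReal (u n ^ (-t)) * ENNReal.ofReal ((2 * u n) ^ t') := by gcongr
      _ ≤ ENNReal.ofReal (2 ^ t') := by
          rw [← ENNReal.ofReal_mul (by positivity)]
          refine ENNReal.ofReal_le_ofReal ?_
          rw [Real.mul_rpow (by norm_num) h0.le, mul_left_comm, ← Real.rpow_add h0]
          exact mul_le_of_le_one_right (by positivity)
            (Real.rpow_le_one h0.le h1.le (by linarith))
  have h := dimH_le_of_hausdorffMeasure_ne_top (d := t'.toNNReal)
    (by rwa [Real.coe_toNNReal _ ht'0.le])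
  calc (dimH A : EReal) ≤ (ENNReal.ofReal t' : EReal) := by exact_mod_cast h
    _ = t' := by rw [EReal.coe_ennreal_ofReal, max_eq_left ht'0.le]

/-! ### Similar sets and realizations of the construction -/

section Similar

variable {d : ℕ}

lemma diam_image_of_dist_eq {f : Euc d → Euc d} {r : ℝ} (hr : 0 < r)
    (hf : ∀ x y, dist (f x) (f y) = r * dist x y) {A : Set (Euc d)} (hA : Bornology.IsBounded A) :
    Metric.diam (f '' A) = r * Metric.diam A := by
  have hb : ∀ x ∈ f '' A, ∀ y ∈ f '' A, dist x y ≤ r * Metric.diam A := by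
    rintro _ ⟨x, hx, rfl⟩ _ ⟨y, hy, rfl⟩
    rw [hf]
    exact mul_le_mul_of_nonneg_left (Metric.dist_le_diam_of_mem hA hx hy) hr.le
  refine le_antisymm (Metric.diam_le_of_forall_dist_le (by positivity) hb) ?_
  rw [← le_div_iff₀' hr]
  refine Metric.diam_le_of_forall_dist_le (by positivity) fun x hx y hy => ?_
  rw [le_div_iff₀' hr, ← hf]
  exact Metric.dist_le_diam_of_mem (Metric.isBounded_iff.2 ⟨_, fun _ h _ h' => hb _ h _ h'⟩)
    ⟨x, hx, rfl⟩ ⟨y, hy, rfl⟩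

lemma GeomSimilar.diam_pos {A B : Set (Euc d)} (h : GeomSimilar A B) (hA : IsCompact A)
    (hd : Metric.diam A = 1) : 0 < Metric.diam B := by
  obtain ⟨f, ⟨r, hr, hf⟩, rfl⟩ := h
  rw [diam_image_of_dist_eq hr hf hA.isBounded, hd, mul_one]
  exact hr

/-- A point of A at distance ε from the image of f has an orbit whose points are pairwise
ε-separated, which compactness excludes. -/
lemma image_eq_of_isometry_of_isCompact {X : Type*} [MetricSpace X] {A : Set X} (hA : IsCompact A)
    {f : X → X} (hf : ∀ x y, dist (f x) (f y) = dist x y) (h : f '' A ⊆ A) : f '' A = A := by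
  refine h.antisymm fun x hx => ?_
  by_contra hxA
  have hfi : Isometry f := Isometry.of_dist_eq hf
  obtain ⟨ε, hε, hball⟩ := Metric.isOpen_iff.1 (hA.image hfi.continuous).isClosed.isOpen_compl x hxA
  have hmem : ∀ n, f^[n] x ∈ A := by
    intro n
    induction n with
    | zero => exact hx
    | succ n ih => rw [Function.iterate_succ_apply']; exact h ⟨_, ih, rfl⟩
  have hit : ∀ m y z, dist (f^[m] y) (f^[m] z) = dist y z := by
    intro m
    induction m with
    | zero => simp
    | succ m ih => intro y z; rw [Function.iterate_succ_apply, Function.iterate_succ_apply, ih, hf]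
  have hsep : ∀ m n, m < n → ε ≤ dist (f^[n] x) (f^[m] x) := by
    intro m n hmn
    obtain ⟨k, rfl⟩ := Nat.exists_eq_add_of_lt hmn
    rw [add_assoc, Function.iterate_add_apply, hit m,
      Function.iterate_succ_apply']
    by_contra hlt
    exact hball (Metric.mem_ball.2 (not_le.1 hlt)) ⟨_, hmem k, rfl⟩
  obtain ⟨_, -, φ, hφ, hlim⟩ := hA.tendsto_subseq hmem
  obtain ⟨N, hN⟩ := Metric.cauchySeq_iff'.1 hlim.cauchySeq ε hε
  exact absurd (hN (N + 1) (by omega)) (not_lt.2 (hsep _ _ (hφ (by omega))))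

/-- With equal diameters the similarity would be an isometry of a compact set into itself, hence
onto. This makes the first-level ratios strictly less than 1. -/
lemma GeomSimilar.diam_lt_of_subset {A B : Set (Euc d)} (h : GeomSimilar A B) (hA : IsCompact A)
    (hd : Metric.diam A = 1) (hsub : B ⊆ A) (hne : B ≠ A) : Metric.diam B < 1 := by
  have hle : Metric.diam B ≤ 1 := hd ▸ Metric.diam_mono hsub hA.isBounded
  refine hle.lt_of_ne fun heq => hne ?_
  obtain ⟨f, ⟨r, hr, hf⟩, rfl⟩ := h
  rw [diam_image_of_dist_eq hr hf hA.isBounded, hd, mul_one] at heq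
  exact image_eq_of_isometry_of_isCompact hA (fun x y => by rw [hf, heq, one_mul]) hsub

/-- Scale invariance: a similarity taking p to a point of J and radius r to 2 reduces a ball at any
scale to the hypothesis with ε = 2 > diam J. -/
lemma NeighborhoodBounded.exists_encard_le {J : Set (Euc d)} (h : NeighborhoodBounded J)
    (hd : Metric.diam J = 1) (ι : Type*) :
    ∃ n₀ : ℕ, ∀ (p : Euc d) (r : ℝ) (s : Set ι) (A : ι → Set (Euc d)), 0 < r →
      (∀ i ∈ s, GeomSimilar J (A i)) →
      (∀ i ∈ s, ∀ j ∈ s, i ≠ j → Disjoint (interior (A i)) (interior (A j))) →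
      (∀ i ∈ s, r ≤ Metric.diam (A i)) →
      (∀ i ∈ s, ∃ y ∈ A i, dist p y < r) →
      s.encard ≤ n₀ := by
  obtain ⟨n₀, hn⟩ := h
  refine ⟨n₀, fun p r s A hr hsim hdisj hdiam hdist => ?_⟩
  by_contra hlt
  have hlt : ((n₀ + 1 : ℕ) : ℕ∞) ≤ s.encard := by
    push_cast
    exact Order.add_one_le_of_lt (not_le.1 hlt)
  obtain ⟨t, hts, ht⟩ := Set.exists_subset_encard_eq hlt
  have htf : t.Finite := Set.finite_of_encard_eq_coe ht
  rw [htf.encard_eq_coe_toFinset_card, Nat.cast_inj] at ht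
  obtain ⟨z, hz⟩ : J.Nonempty := by
    by_contra hemp
    rw [Set.not_nonempty_iff_eq_empty.1 hemp, Metric.diam_empty] at hd
    exact zero_ne_one hd
  let e : Fin (n₀ + 1) ≃ htf.toFinset := (htf.toFinset.equivFinOfCardEq ht).symm
  have hes : ∀ k, (e k : ι) ∈ s := fun k => hts (htf.mem_toFinset.1 (e k).2)
  have h2r : (2 / r : ℝ) ≠ 0 := by positivity
  let g : Euc d ≃ₜ Euc d :=
    ((Homeomorph.subRight p).trans (Homeomorph.smulOfNeZero (2 / r) h2r)).trans (Homeomorph.addLeft z)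
  have hg : ∀ y, g y = z + (2 / r) • (y - p) := fun y => rfl
  have hgd : ∀ y y', dist (g y) (g y') = (2 / r) * dist y y' := by
    intro y y'
    rw [hg, hg, dist_add_left, dist_smul₀, dist_sub_right, Real.norm_of_nonneg (by positivity)]
  refine absurd (hn 2 (by rw [hd]; norm_num) (n₀ + 1) (fun k => g '' A (e k)) ?_ ?_ ?_ ?_) (by omega)
  · intro k
    obtain ⟨f, ⟨q, hq, hf⟩, hfA⟩ := hsim _ (hes k)
    refine ⟨g ∘ f, ⟨2 / r * q, by positivity, fun x y => ?_⟩, ?_⟩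
    · rw [Function.comp_apply, Function.comp_apply, hgd, hf, mul_assoc]
    · rw [Set.image_comp, hfA]
  · intro i j hij
    rw [← g.image_interior, ← g.image_interior]
    refine (Set.disjoint_image_iff g.injective).2 (hdisj _ (hes i) _ (hes j) fun h => hij ?_)
    exact e.injective (Subtype.ext h)
  · intro k
    have hbdd : Bornology.IsBounded (A (e k)) := by
      by_contra hb
      have := hdiam _ (hes k)
      rw [Metric.diam_eq_zero_of_unbounded hb] at this
      linarith
    change 2 ≤ Metric.diam (g '' _)
    rw [diam_image_of_dist_eq (by positivity) hgd hbdd, div_mul_eq_mul_div, le_div_iff₀ hr]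
    have := hdiam _ (hes k)
    linarith
  · intro k
    obtain ⟨y, hy, hpy⟩ := hdist _ (hes k)
    refine ⟨z, hz, g y, ⟨y, hy, rfl⟩, ?_⟩
    have : z = g p := by rw [hg, sub_self, smul_zero, add_zero]
    rw [this, hgd, div_mul_eq_mul_div, div_lt_iff₀ hr]
    linarith

end Similar

section Realization

variable {d : ℕ} {Δ Ω : Type*} {J₀ : Compacts (Euc d)} {J : List Δ → Ω → Compacts (Euc d)} {ω : Ω}

/-- The almost sure geometric properties of a realization of a random recursive construction. -/
structure IsRegularAt (J₀ : Compacts (Euc d)) (J : List Δ → Ω → Compacts (Euc d)) (ω : Ω) :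
    Prop where
  diam_seed : Metric.diam (J₀ : Set (Euc d)) = 1
  root : J [] ω = J₀
  similar : ∀ σ, (J σ ω : Set (Euc d)).Nonempty → GeomSimilar (J₀ : Set (Euc d)) (J σ ω : Set (Euc d))
  nested : ∀ σ i, (J (σ ++ [i]) ω : Set (Euc d)) ⊆ J σ ω
  child_ne : ∀ i, J [i] ω ≠ J₀
  disjoint_interior : ∀ σ τ : List Δ, σ.length = τ.length → σ ≠ τ →
    interior (J σ ω : Set (Euc d)) ∩ interior (J τ ω : Set (Euc d)) = ∅

/-- `n₀` bounds the number of incomparable cells of size at least `r` that meet a ball of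
radius `r`. -/
def CellCountBound (J : List Δ → Ω → Compacts (Euc d)) (ω : Ω) (n₀ : ℕ) : Prop :=
  ∀ (p : Euc d) (r : ℝ) (s : Set (List Δ)), 0 < r →
    (∀ σ ∈ s, ∀ τ ∈ s, σ ≠ τ → ¬ σ <+: τ) →
    (∀ σ ∈ s, r ≤ cellDiam J σ ω) → (∀ σ ∈ s, ∃ y ∈ J σ ω, dist p y < r) → s.encard ≤ n₀

lemma cellDiam_nonneg (σ : List Δ) : 0 ≤ cellDiam J σ ω := Metric.diam_nonneg

lemma nonempty_of_cellDiam_pos {σ : List Δ} (h : 0 < cellDiam J σ ω) :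
    (J σ ω : Set (Euc d)).Nonempty := by
  by_contra hemp
  rw [cellDiam, Set.not_nonempty_iff_eq_empty.1 hemp, Metric.diam_empty] at h
  exact lt_irrefl _ h

namespace IsRegularAt

variable (hR : IsRegularAt J₀ J ω)
include hR

lemma cellDiam_pos {σ : List Δ} (h : (J σ ω : Set (Euc d)).Nonempty) : 0 < cellDiam J σ ω :=
  (hR.similar σ h).diam_pos J₀.isCompact hR.diam_seed

lemma cellDiam_nil : cellDiam J [] ω = 1 := by
  rw [cellDiam, hR.root, hR.diam_seed]

lemma nonempty_nil : (J [] ω : Set (Euc d)).Nonempty :=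
  nonempty_of_cellDiam_pos (by rw [hR.cellDiam_nil]; exact one_pos)

lemma subset_append (σ τ : List Δ) : (J (σ ++ τ) ω : Set (Euc d)) ⊆ J σ ω := by
  induction τ using List.reverseRecOn with
  | nil => simp
  | append_singleton τ i ih =>
    rw [← List.append_assoc]
    exact (hR.nested _ i).trans ih

lemma subset_of_prefix {σ τ : List Δ} (h : σ <+: τ) : (J τ ω : Set (Euc d)) ⊆ J σ ω := by
  obtain ⟨ρ, rfl⟩ := h
  exact hR.subset_append σ ρ

lemma cellDiam_le_of_prefix {σ τ : List Δ} (h : σ <+: τ) : cellDiam J τ ω ≤ cellDiam J σ ω :=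
  Metric.diam_mono (hR.subset_of_prefix h) (J σ ω).isCompact.isBounded

/-- The open set condition only speaks of words of equal length, so the longer word is cut to the
length of the shorter. -/
lemma disjoint_interior_of_not_prefix {σ τ : List Δ} (h : ¬ σ <+: τ) (h' : ¬ τ <+: σ) :
    Disjoint (interior (J σ ω : Set (Euc d))) (interior (J τ ω : Set (Euc d))) := by
  wlog hle : σ.length ≤ τ.length generalizing σ τ
  · exact (this h' h (le_of_not_ge hle)).symm
  have hne : σ ≠ τ.take σ.length := fun he => h (he ▸ List.take_prefix _ _)
  have := hR.disjoint_interior σ (τ.take σ.length) (by simp [hle]) hne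
  exact (Set.disjoint_iff_inter_eq_empty.2 this).mono_right
    (interior_mono (hR.subset_of_prefix (List.take_prefix _ _)))

lemma mem_limitSet {y : Euc d} : y ∈ limitSet J ω ↔ ∀ k, ∃ σ : List Δ, σ.length = k ∧ y ∈ J σ ω := by
  simp only [limitSet, Set.mem_iInter, Set.mem_iUnion, exists_prop, SetLike.mem_coe]
  refine ⟨fun h k => ?_, fun h k _ => h k⟩
  obtain ⟨σ, hσ, hy⟩ := h (k + 1) (by omega)
  exact ⟨σ.take k, by simp [hσ], hR.subset_of_prefix (List.take_prefix _ _) hy⟩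

lemma ratioVector_mem {σ : List Δ} (i : Δ) :
    0 ≤ ratioVector J σ ω i ∧ ratioVector J σ ω i ≤ 1 :=
  ⟨div_nonneg (cellDiam_nonneg _) (cellDiam_nonneg _),
    div_le_one_of_le₀ (hR.cellDiam_le_of_prefix (List.prefix_append _ _)) (cellDiam_nonneg _)⟩

lemma ratioVector_nil_lt_one (i : Δ) : ratioVector J [] ω i < 1 := by
  rw [ratioVector, hR.cellDiam_nil, div_one, List.nil_append]
  by_cases h : (J [i] ω : Set (Euc d)).Nonempty
  · refine (hR.similar _ h).diam_lt_of_subset J₀.isCompact hR.diam_seed ?_ ?_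
    · simpa [hR.root] using hR.nested [] i
    · exact fun he => hR.child_ne i (SetLike.coe_injective he)
  · rw [cellDiam, Set.not_nonempty_iff_eq_empty.1 h, Metric.diam_empty]
    exact one_pos

lemma cellDiam_append_singleton {σ : List Δ} (h : (J σ ω : Set (Euc d)).Nonempty) (i : Δ) :
    cellDiam J (σ ++ [i]) ω = ratioVector J σ ω i * cellDiam J σ ω := by
  rw [ratioVector, div_mul_cancel₀ _ (hR.cellDiam_pos h).ne']

end IsRegularAt

lemma exists_cellCountBound (hnbd : NeighborhoodBounded (J₀ : Set (Euc d)))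
    (hd : Metric.diam (J₀ : Set (Euc d)) = 1) (J : List Δ → Ω → Compacts (Euc d)) :
    ∃ n₀ : ℕ, ∀ ω, IsRegularAt J₀ J ω → CellCountBound J ω n₀ := by
  obtain ⟨n₀, hn⟩ := hnbd.exists_encard_le hd (List Δ)
  refine ⟨n₀, fun ω hR p r s hr hanti hdiam hdist =>
    hn p r s (fun σ => J σ ω) hr (fun σ hσ => hR.similar σ ?_) (fun σ hσ τ hτ hne => ?_) hdiam hdist⟩
  · exact nonempty_of_cellDiam_pos (hr.trans_le (hdiam σ hσ))
  · exact hR.disjoint_interior_of_not_prefix (hanti σ hσ τ hτ hne) (hanti τ hτ σ hσ hne.symm)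

variable {S : List Δ → Δ → Ω → Euc d → Euc d}

lemma IsSimilaritySystem.map_mem (hS : IsSimilaritySystem J S) {τ : List Δ} {i : Δ} {y : Euc d}
    (hy : y ∈ J τ ω) (h : (J (τ ++ [i]) ω : Set (Euc d)).Nonempty) : S τ i ω y ∈ J (τ ++ [i]) ω := by
  have := (hS τ i ω ⟨y, hy⟩ h).2
  exact this.subset ⟨y, hy, rfl⟩

lemma dist_le_cellDiam {σ : List Δ} {y z : Euc d} (hy : y ∈ J σ ω) (hz : z ∈ J σ ω) :
    dist y z ≤ cellDiam J σ ω :=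
  Metric.dist_le_diam_of_mem (J σ ω).isCompact.isBounded hy hz

lemma ballCount_firstOrbit_le (hS : IsSimilaritySystem J S) {n₀ : ℕ} (hn : CellCountBound J ω n₀)
    {τ : List Δ} {y : Euc d} (hy : y ∈ J τ ω) {r : ℝ} (hr : 0 < r) :
    ballCount (3 * r) (firstOrbit J S τ ω y) ≤ (n₀ + 1 : ENNReal) * ballCount r (limitSet J ω) := by
  rcases eq_top_or_lt_top (ballCount r (limitSet J ω)) with htop | hlt
  · rw [htop, ENNReal.mul_top (by positivity)]
    exact le_top
  obtain ⟨C, hC, hcard⟩ := exists_cover_of_ballCount_lt_top hr.le hlt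
  -- The large children (size above 2r) that meet the ball of radius r about c. Their orbit points
  -- join the cover as centres; a small child has its orbit point within 2r + r of c.
  let I : Euc d → Set (List Δ) := fun c => {σ | ∃ i, σ = τ ++ [i] ∧ 2 * r < cellDiam J σ ω ∧
    ∃ k ∈ J σ ω, dist k c ≤ r}
  have hI : ∀ c, (I c).encard ≤ n₀ := by
    intro c
    refine hn c (2 * r) (I c) (by positivity) ?_ ?_ ?_
    · rintro _ ⟨i, rfl, -⟩ _ ⟨j, rfl, -⟩ hne hp
      exact hne (hp.eq_of_length (by simp))
    · rintro _ ⟨i, rfl, h, -⟩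
      exact h.le
    · rintro _ ⟨i, rfl, -, k, hk, hkc⟩
      exact ⟨k, hk, by rw [dist_comm]; linarith⟩
  have hne : ∀ σ : List Δ, ∃ z, ∀ i, σ = τ ++ [i] → z = S τ i ω y := by
    intro σ
    by_cases h : ∃ i, σ = τ ++ [i]
    · obtain ⟨i, rfl⟩ := h
      refine ⟨S τ i ω y, fun j hj => ?_⟩
      have : i = j := by simpa using hj
      rw [this]
    · exact ⟨0, fun i hi => absurd ⟨i, hi⟩ h⟩
  choose g hg using hne
  refine (ballCount_le_encard ((C : Set (Euc d)) ∪ ⋃ c ∈ C, g '' I c) ?_).trans ?_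
  · rintro z ⟨i, ⟨k, hk, hkK⟩, rfl⟩
    obtain ⟨c, hc, hkc⟩ := hC k hkK
    have hmem : S τ i ω y ∈ J (τ ++ [i]) ω := hS.map_mem hy ⟨k, hk⟩
    by_cases hsize : 2 * r < cellDiam J (τ ++ [i]) ω
    · refine ⟨S τ i ω y, Or.inr ?_, by rw [dist_self]; positivity⟩
      simp only [Set.mem_iUnion]
      exact ⟨c, hc, τ ++ [i], ⟨i, rfl, hsize, k, hk, hkc⟩, hg _ i rfl⟩
    · refine ⟨c, Or.inl hc, ?_⟩
      have h1 := dist_le_cellDiam hmem hk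
      have h2 := dist_triangle (S τ i ω y) k c
      linarith
  · have : ((C : Set (Euc d)) ∪ ⋃ c ∈ C, g '' I c).encard ≤ ((C.card + C.card * n₀ : ℕ) : ℕ∞) := by
      refine (Set.encard_union_le _ _).trans ?_
      push_cast
      refine add_le_add (by simp) ((Finset.set_encard_biUnion_le _ _).trans ?_)
      refine (Finset.sum_le_sum fun c _ => (Set.encard_image_le _ _).trans (hI c)).trans ?_
      simp
    refine (ENat.toENNReal_le.2 this).trans (le_of_eq ?_)
    rw [hcard]
    push_cast
    ring

end Realization

/-! ### Independent marks on the tree of words -/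

section Tree

variable {Δ X : Type*}

/-- The marks below the word `σ`. -/
def subtree (σ : List Δ) (v : List Δ → X) : List Δ → X := fun τ => v (σ ++ τ)

variable [MeasurableSpace X]

/-- The `σ`-algebra generated by the marks at the words of `s`. -/
abbrev marksAlgebra (X : Type*) [MeasurableSpace X] (s : Set (List Δ)) :
    MeasurableSpace (List Δ → X) :=
  ⨆ σ ∈ s, MeasurableSpace.comap (fun v => v σ) inferInstance

lemma marksAlgebra_le (s : Set (List Δ)) :
    marksAlgebra X s ≤ (inferInstance : MeasurableSpace (List Δ → X)) :=
  iSup₂_le fun σ _ => (measurable_pi_apply σ).comap_le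

lemma measurable_mark {s : Set (List Δ)} {σ : List Δ} (h : σ ∈ s) :
    Measurable[marksAlgebra X s] (fun v : List Δ → X => v σ) :=
  (comap_measurable _).mono (le_iSup₂ (f := fun σ (_ : σ ∈ s) =>
    MeasurableSpace.comap (fun v : List Δ → X => v σ) inferInstance) σ h) le_rfl

lemma measurable_subtree_marksAlgebra (σ : List Δ) :
    Measurable[marksAlgebra X {τ | σ <+: τ}] (subtree (X := X) σ) := by
  refine @measurable_pi_lambda _ _ _ (marksAlgebra X {τ | σ <+: τ}) _ _ fun τ => ?_
  exact measurable_mark (List.prefix_append σ τ)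

lemma measurable_subtree (σ : List Δ) : Measurable (subtree (X := X) σ) :=
  (measurable_subtree_marksAlgebra σ).mono (marksAlgebra_le _) le_rfl

variable (ν : Measure X) [IsProbabilityMeasure ν]

/-- The law of a family of independent marks with law `ν`. -/
abbrev treeMeasure (Δ : Type*) {X : Type*} [MeasurableSpace X] (ν : Measure X) :
    Measure (List Δ → X) := Measure.infinitePi (fun _ : List Δ => ν)

lemma measurePreserving_subtree (σ : List Δ) :
    MeasurePreserving (subtree σ) (treeMeasure Δ ν) (treeMeasure Δ ν) :=
  ⟨measurable_subtree σ, Measure.map_infinitePi_infinitePi_of_inj (P := fun _ : List Δ => ν)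
    (List.append_right_injective σ)⟩

lemma indep_marksAlgebra {s t : Set (List Δ)} (h : Disjoint s t) :
    Indep (marksAlgebra X s) (marksAlgebra X t) (treeMeasure Δ ν) := by
  have h1 : iIndepFun (fun (σ : List Δ) (v : List Δ → X) => v σ) (treeMeasure Δ ν) :=
    iIndepFun_infinitePi (X := fun _ x => x) (by fun_prop)
  exact indep_iSup_of_disjoint (fun σ => (measurable_pi_apply σ).comap_le) h1 h

lemma lintegral_mul_of_disjoint {s t : Set (List Δ)} (h : Disjoint s t) {f g : (List Δ → X) → ENNReal}
    (hf : Measurable[marksAlgebra X s] f) (hg : Measurable[marksAlgebra X t] g) :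
    ∫⁻ v, f v * g v ∂treeMeasure Δ ν = (∫⁻ v, f v ∂treeMeasure Δ ν) * ∫⁻ v, g v ∂treeMeasure Δ ν :=
  lintegral_mul_eq_lintegral_mul_lintegral_of_independent_measurableSpace (marksAlgebra_le _)
    (marksAlgebra_le _) (indep_marksAlgebra ν h) hf hg

lemma lintegral_mark {f : X → ENNReal} (hf : Measurable f) (σ : List Δ) :
    ∫⁻ v, f (v σ) ∂treeMeasure Δ ν = ∫⁻ x, f x ∂ν :=
  (measurePreserving_eval_infinitePi (fun _ : List Δ => ν) σ).lintegral_comp hf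

lemma lintegral_subtree {f : (List Δ → X) → ENNReal} (hf : Measurable f) (σ : List Δ) :
    ∫⁻ v, f (subtree σ v) ∂treeMeasure Δ ν = ∫⁻ v, f v ∂treeMeasure Δ ν :=
  (measurePreserving_subtree ν σ).lintegral_comp hf

lemma lintegral_root_mul_subtree {f : X → ENNReal} (hf : Measurable f)
    {g : (List Δ → X) → ENNReal} (hg : Measurable g) (i : Δ) :
    ∫⁻ v, f (v []) * g (subtree [i] v) ∂treeMeasure Δ ν =
      (∫⁻ x, f x ∂ν) * ∫⁻ v, g v ∂treeMeasure Δ ν := by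
  rw [← lintegral_mark ν hf ([] : List Δ), ← lintegral_subtree ν hg [i]]
  refine lintegral_mul_of_disjoint ν (s := {[]}) (t := {τ | [i] <+: τ}) ?_ ?_ ?_
  · rw [Set.disjoint_singleton_left]
    simp
  · exact hf.comp (measurable_mark rfl)
  · exact hg.comp (measurable_subtree_marksAlgebra [i])

/-! ### Total weight of all words -/

/-- The product of the weights along a word. -/
def wordWeight (b : Δ → X → ENNReal) : List Δ → (List Δ → X) → ENNReal
  | [], _ => 1
  | i :: σ, v => b i (v []) * wordWeight b σ (subtree [i] v)

omit [MeasurableSpace X] in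
lemma wordWeight_append_singleton (b : Δ → X → ENNReal) (σ : List Δ) (i : Δ) (v : List Δ → X) :
    wordWeight b (σ ++ [i]) v = wordWeight b σ v * b i (v σ) := by
  induction σ generalizing v with
  | nil => simp [wordWeight]
  | cons j σ ih =>
    rw [List.cons_append, wordWeight, ih, wordWeight, mul_assoc]
    rfl

lemma measurable_wordWeight {b : Δ → X → ENNReal} (hb : ∀ i, Measurable (b i)) (σ : List Δ) :
    Measurable (wordWeight b σ) := by
  induction σ with
  | nil => exact measurable_const
  | cons i σ ih =>
    exact ((hb i).comp (measurable_pi_apply _)).mul (ih.comp (measurable_subtree _))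

/-- The weight at the root is independent of the marks below the first letter, so the expectation
factors letter by letter. -/
lemma lintegral_wordWeight {b : Δ → X → ENNReal} (hb : ∀ i, Measurable (b i)) (σ : List Δ) :
    ∫⁻ v, wordWeight b σ v ∂treeMeasure Δ ν = (σ.map fun i => ∫⁻ x, b i x ∂ν).prod := by
  induction σ with
  | nil => simp [wordWeight]
  | cons i σ ih =>
    simp only [wordWeight, List.map_cons, List.prod_cons]
    rw [lintegral_root_mul_subtree ν (hb i) (measurable_wordWeight hb σ), ih]

lemma tsum_prod_of_length_eq (c : Δ → ENNReal) (k : ℕ) :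
    ∑' σ : List Δ, (if σ.length = k then (σ.map c).prod else 0) = (∑' i, c i) ^ k := by
  induction k with
  | zero =>
    rw [tsum_eq_single ([] : List Δ)]
    · simp
    · intro σ hσ
      simp [hσ]
  | succ k ih =>
    have hinj : Function.Injective (fun p : Δ × List Δ => p.1 :: p.2) := by
      rintro ⟨i, σ⟩ ⟨j, τ⟩ h
      simpa using h
    rw [← hinj.tsum_eq (f := fun σ : List Δ => if σ.length = k + 1 then (σ.map c).prod else 0)]
    · rw [ENNReal.summable.tsum_prod' fun _ => ENNReal.summable, pow_succ', ← ih, ← ENNReal.tsum_mul_right]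
      refine tsum_congr fun i => ?_
      rw [← ENNReal.tsum_mul_left]
      refine tsum_congr fun σ => ?_
      simp
    · intro σ hσ
      cases σ with
      | nil => simp at hσ
      | cons i σ => exact ⟨(i, σ), rfl⟩

lemma ae_tsum_wordWeight_lt_top [Countable Δ] {b : Δ → X → ENNReal} (hb : ∀ i, Measurable (b i))
    (h : ∑' i, ∫⁻ x, b i x ∂ν < 1) :
    ∀ᵐ v ∂treeMeasure Δ ν, ∑' σ, wordWeight b σ v < ⊤ := by
  refine ae_lt_top (Measurable.tsum fun σ => measurable_wordWeight hb σ) ?_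
  rw [lintegral_tsum fun σ => (measurable_wordWeight hb σ).aemeasurable]
  simp_rw [lintegral_wordWeight ν hb]
  have : ∀ σ : List Δ, (σ.map fun i => ∫⁻ x, b i x ∂ν).prod =
      ∑' k, if σ.length = k then (σ.map fun i => ∫⁻ x, b i x ∂ν).prod else 0 := by
    intro σ
    rw [tsum_eq_single σ.length]
    · simp
    · intro k hk
      simp [hk.symm]
  -- Grouping words by length k turns the sum into the geometric series of the mean total weight.
  rw [tsum_congr this, ENNReal.tsum_comm, tsum_congr (tsum_prod_of_length_eq _),
    ENNReal.tsum_geometric]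
  exact ENNReal.inv_ne_top.2 (tsub_pos_of_lt h).ne'

/-! ### Net content of the tree -/

/-- The relative net content of the tree of words up to depth `n`. -/
def netContent (F : Finset Δ) (a : Δ → X → ENNReal) : ℕ → (List Δ → X) → ENNReal
  | 0, _ => 1
  | n + 1, v => min 1 (∑ i ∈ F, a i (v []) * netContent F a n (subtree [i] v))

variable {F : Finset Δ} {a : Δ → X → ENNReal}

omit [MeasurableSpace X] in
lemma netContent_le_one (n : ℕ) (v : List Δ → X) : netContent F a n v ≤ 1 := by
  cases n with
  | zero => exact le_rfl
  | succ n => exact min_le_left _ _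

omit [MeasurableSpace X] in
lemma netContent_succ_le (n : ℕ) (v : List Δ → X) :
    netContent F a (n + 1) v ≤ netContent F a n v := by
  induction n generalizing v with
  | zero => exact netContent_le_one _ _
  | succ n ih =>
    rw [netContent, netContent]
    gcongr
    exact ih _

omit [MeasurableSpace X] in
lemma netContent_antitone (v : List Δ → X) : Antitone (fun n => netContent F a n v) :=
  antitone_nat_of_succ_le fun n => netContent_succ_le n v

lemma measurable_netContent (ha : ∀ i, Measurable (a i)) (n : ℕ) :
    Measurable (netContent F a n) := by
  induction n with
  | zero => exact measurable_const
  | succ n ih =>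
    refine measurable_const.min (Finset.measurable_sum _ fun i _ => ?_)
    exact ((ha i).comp (measurable_pi_apply _)).mul (ih.comp (measurable_subtree _))

/-- If s = Σ x_i ≥ 1, then 2s ≤ 1 + s², and the diagonal part of s² is at most s. Truncation at 1
thus costs only a quadratic error in the cross terms. -/
lemma sum_le_min_one_add {ι : Type*} [DecidableEq ι] (F : Finset ι) (x : ι → ENNReal)
    (hx : ∀ i, x i ≤ 1) :
    ∑ i ∈ F, x i ≤ min 1 (∑ i ∈ F, x i) + ∑ i ∈ F, ∑ j ∈ F.erase i, x i * x j := by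
  rcases le_total (∑ i ∈ F, x i) 1 with h | h
  · rw [min_eq_right h]
    exact le_self_add
  rw [min_eq_left h]
  have hfin : ∑ i ∈ F, x i ≠ ⊤ :=
    ENNReal.sum_ne_top.2 fun i _ => ne_top_of_le_ne_top ENNReal.one_ne_top (hx i)
  have h1 : (∑ i ∈ F, x i) * (∑ i ∈ F, x i) ≤
      (∑ i ∈ F, ∑ j ∈ F.erase i, x i * x j) + ∑ i ∈ F, x i := by
    rw [Finset.sum_mul, ← Finset.sum_add_distrib]
    refine Finset.sum_le_sum fun i hi => ?_
    rw [← Finset.sum_erase_add _ _ hi, mul_add, Finset.mul_sum]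
    gcongr
    exact mul_le_of_le_one_right' (hx i)
  have h2 : (∑ i ∈ F, x i) + (∑ i ∈ F, x i) ≤ 1 + (∑ i ∈ F, x i) * (∑ i ∈ F, x i) := by
    lift (∑ i ∈ F, x i) to NNReal using hfin with y
    norm_cast
    rw [← NNReal.coe_le_coe]
    push_cast
    nlinarith [sq_nonneg ((y : ℝ) - 1)]
  have h3 := h2.trans (add_le_add_right h1 1)
  rw [← add_assoc] at h3
  exact (ENNReal.add_le_add_iff_right hfin).1 h3

lemma sum_mul_lintegral_netContent (ha : ∀ i, Measurable (a i)) (n : ℕ) :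
    ∫⁻ v, ∑ i ∈ F, a i (v []) * netContent F a n (subtree [i] v) ∂treeMeasure Δ ν =
      (∑ i ∈ F, ∫⁻ x, a i x ∂ν) * ∫⁻ v, netContent F a n v ∂treeMeasure Δ ν := by
  have hm := measurable_netContent (F := F) ha n
  rw [lintegral_finsetSum, Finset.sum_mul]
  · exact Finset.sum_congr rfl fun i _ => lintegral_root_mul_subtree ν (ha i) hm i
  · exact fun i _ => ((ha i).comp (measurable_pi_apply _)).mul (hm.comp (measurable_subtree _))

lemma lintegral_netContent_ne_zero (ha : ∀ i, Measurable (a i)) (ha1 : ∀ i x, a i x ≤ 1)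
    (h : 1 < ∑ i ∈ F, ∫⁻ x, a i x ∂ν) (n : ℕ) :
    ∫⁻ v, netContent F a n v ∂treeMeasure Δ ν ≠ 0 := by
  induction n with
  | zero => simp [netContent]
  | succ n ih =>
    intro h0
    have hpt : ∀ v : List Δ → X, ∑ i ∈ F, a i (v []) * netContent F a n (subtree [i] v) ≤
        (F.card : ENNReal) * netContent F a (n + 1) v := by
      intro v
      have hcard : (1 : ENNReal) ≤ F.card := by
        have : F.Nonempty := by
          by_contra hF
          simp [Finset.not_nonempty_iff_eq_empty.1 hF] at h
        exact_mod_cast this.card_pos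
      rw [netContent]
      rcases min_choice 1 (∑ i ∈ F, a i (v []) * netContent F a n (subtree [i] v)) with he | he <;>
        rw [he]
      · rw [mul_one, Finset.card_eq_sum_ones]
        push_cast
        exact Finset.sum_le_sum fun i _ => mul_le_one' (ha1 i _) (netContent_le_one _ _)
      · exact le_mul_of_one_le_left' hcard
    have := lintegral_mono (μ := treeMeasure Δ ν) hpt
    rw [sum_mul_lintegral_netContent ν ha, lintegral_const_mul _ (measurable_netContent ha _), h0,
      mul_zero, nonpos_iff_eq_zero, mul_eq_zero] at this
    exact this.elim (by positivity) ih

/-- With m the mean total weight and f the expected net content, the cross-term estimate gives m f ≤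
f + |F|² f². Division by f > 0 leaves a lower bound for f that does not depend on n. -/
lemma sum_lintegral_le_one_add (ha : ∀ i, Measurable (a i)) (ha1 : ∀ i x, a i x ≤ 1)
    (h : 1 < ∑ i ∈ F, ∫⁻ x, a i x ∂ν) (n : ℕ) :
    ∑ i ∈ F, ∫⁻ x, a i x ∂ν ≤
      1 + (F.card * F.card : ENNReal) * ∫⁻ v, netContent F a n v ∂treeMeasure Δ ν := by
  classical
  have hm := measurable_netContent (F := F) ha n
  have hm' : ∀ i, Measurable fun v : List Δ → X => a i (v []) * netContent F a n (subtree [i] v) :=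
    fun i => ((ha i).comp (measurable_pi_apply _)).mul (hm.comp (measurable_subtree _))
  set f := ∫⁻ v, netContent F a n v ∂treeMeasure Δ ν with hf
  have hf0 : f ≠ 0 := lintegral_netContent_ne_zero ν ha ha1 h n
  have hf1 : f ≠ ⊤ := by
    refine ne_top_of_le_ne_top ENNReal.one_ne_top ?_
    calc f ≤ ∫⁻ _, 1 ∂treeMeasure Δ ν := lintegral_mono fun v => netContent_le_one n v
      _ = 1 := by simp
  -- The weights of siblings may be dependent, so they are bounded by 1; the subtrees below
  -- different letters are independent.
  have hoff : ∀ i j, j ≠ i → ∫⁻ v, (a i (v []) * netContent F a n (subtree [i] v)) *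
      (a j (v []) * netContent F a n (subtree [j] v)) ∂treeMeasure Δ ν ≤ f * f := by
    intro i j hij
    calc _ ≤ ∫⁻ v, netContent F a n (subtree [i] v) * netContent F a n (subtree [j] v)
          ∂treeMeasure Δ ν := lintegral_mono fun v => by
            gcongr <;> exact mul_le_of_le_one_left' (ha1 _ _)
      _ = _ := by
        refine (lintegral_mul_of_disjoint ν (s := {τ | [i] <+: τ}) (t := {τ | [j] <+: τ}) ?_
          (hm.comp (measurable_subtree_marksAlgebra [i]))
          (hm.comp (measurable_subtree_marksAlgebra [j]))).trans ?_
        · rw [Set.disjoint_left]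
          intro τ h1 h2
          cases τ with
          | nil => simp at h1
          | cons k τ =>
            simp only [Set.mem_ofPred_eq, List.cons_prefix_cons] at h1 h2
            exact hij (h2.1.trans h1.1.symm)
        · exact congrArg₂ _ (lintegral_subtree ν hm [i]) (lintegral_subtree ν hm [j])
  have hmain : (∑ i ∈ F, ∫⁻ x, a i x ∂ν) * f ≤ (1 + (F.card * F.card : ENNReal) * f) * f := by
    rw [hf, ← sum_mul_lintegral_netContent ν ha, ← hf]
    calc _ ≤ ∫⁻ v, (netContent F a (n + 1) v + ∑ i ∈ F, ∑ j ∈ F.erase i,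
          (a i (v []) * netContent F a n (subtree [i] v)) *
            (a j (v []) * netContent F a n (subtree [j] v))) ∂treeMeasure Δ ν :=
          lintegral_mono fun v => sum_le_min_one_add F _ fun i =>
            mul_le_one' (ha1 _ _) (netContent_le_one _ _)
      _ ≤ f + ∑ i ∈ F, ∑ j ∈ F.erase i, f * f := by
        rw [lintegral_add_left (measurable_netContent ha _)]
        refine add_le_add (lintegral_mono fun v => netContent_succ_le n v) ?_
        rw [lintegral_finsetSum _
          fun i _ => Finset.measurable_sum _ fun j _ => (hm' i).fun_mul (hm' j)]
        refine Finset.sum_le_sum fun i _ => ?_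
        rw [lintegral_finsetSum _ fun j _ => (hm' i).fun_mul (hm' j)]
        exact Finset.sum_le_sum fun j hj => hoff i j (Finset.ne_of_mem_erase hj)
      _ ≤ f + ∑ i ∈ F, ∑ j ∈ F, f * f := by
        gcongr
        exact Finset.erase_subset _ _
      _ = _ := by
        simp only [Finset.sum_const, nsmul_eq_mul]
        ring
  exact (ENNReal.mul_le_mul_iff_left hf0 hf1).1 hmain

lemma measure_iInf_netContent_pos (ha : ∀ i, Measurable (a i)) (ha1 : ∀ i x, a i x ≤ 1)
    (h : 1 < ∑ i ∈ F, ∫⁻ x, a i x ∂ν) :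
    treeMeasure Δ ν {v | 0 < ⨅ n, netContent F a n v} ≠ 0 := by
  intro h0
  have hae : ∀ᵐ v ∂treeMeasure Δ ν, ⨅ n, netContent F a n v = 0 := by
    rw [← compl_mem_ae_iff] at h0
    filter_upwards [h0] with v hv
    simpa using hv
  have hint : ⨅ n, ∫⁻ v, netContent F a n v ∂treeMeasure Δ ν = 0 := by
    rw [← lintegral_iInf (measurable_netContent ha) (fun _ _ hmn v => netContent_antitone v hmn)]
    · rw [lintegral_congr_ae hae, lintegral_zero]
    · simp [netContent]
  have hlim : Tendsto (fun n => ∫⁻ v, netContent F a n v ∂treeMeasure Δ ν) atTop (𝓝 0) := by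
    rw [← hint]
    exact tendsto_atTop_iInf fun m n hmn => lintegral_mono fun v => netContent_antitone v hmn
  have hlim2 : Tendsto (fun n => 1 + (F.card * F.card : ENNReal) *
      ∫⁻ v, netContent F a n v ∂treeMeasure Δ ν) atTop (𝓝 (1 + (F.card * F.card : ENNReal) * 0)) :=
    tendsto_const_nhds.add (ENNReal.Tendsto.const_mul hlim (Or.inr (by finiteness)))
  rw [mul_zero, add_zero] at hlim2
  exact absurd (ge_of_tendsto' hlim2 (sum_lintegral_le_one_add ν ha ha1 h)) (not_le.2 h)

end Tree

/-! ### Good subtrees occur almost surely on survival -/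

section Survival

variable {Δ X : Type*} [MeasurableSpace X]

/-- All letters of the word `σ` are admitted by the marks, where the letter `i` is admitted by
the marks in `e i`. -/
def IsAlive (e : Δ → Set X) (σ : List Δ) (v : List Δ → X) : Prop :=
  ∀ τ i, τ ++ [i] <+: σ → v τ ∈ e i

omit [MeasurableSpace X] in
lemma isAlive_append_singleton {e : Δ → Set X} {σ : List Δ} {i : Δ} {v : List Δ → X} :
    IsAlive e (σ ++ [i]) v ↔ IsAlive e σ v ∧ v σ ∈ e i := by
  constructor
  · exact fun h => ⟨fun τ j hp => h τ j (hp.trans (List.prefix_append _ _)), h σ i List.prefix_rfl⟩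
  · rintro ⟨h1, h2⟩ τ j hp
    rcases List.prefix_concat_iff.1 hp with he | hp
    · obtain ⟨rfl, he⟩ := List.append_inj' he rfl
      obtain rfl : j = i := by simpa using he
      exact h2
    · exact h1 τ j hp

variable [Countable Δ]

lemma measurableSet_isAlive {e : Δ → Set X} (he : ∀ i, MeasurableSet (e i)) (σ : List Δ) :
    MeasurableSet[marksAlgebra X {τ | τ.length < σ.length}] {v | IsAlive e σ v} := by
  have : {v : List Δ → X | IsAlive e σ v} =
      ⋂ τ, ⋂ i, ⋂ _ : τ ++ [i] <+: σ, (fun v => v τ) ⁻¹' e i := by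
    ext v
    simp [IsAlive]
  rw [this]
  refine @MeasurableSet.iInter _ _ (_) _ _ fun τ => @MeasurableSet.iInter _ _ (_) _ _ fun i =>
    @MeasurableSet.iInter _ _ (_) _ _ fun hp => measurable_mark ?_ (he i)
  have := hp.length_le
  simp only [List.length_append, List.length_singleton] at this
  exact Nat.lt_of_succ_le this

variable (ν : Measure X) [IsProbabilityMeasure ν]

/-- Reveal the marks shorter than n and take the first alive word of length n in a fixed
enumeration. Its subtree is independent of what was revealed, so it misses G with probability μ(Gᶜ).
-/
lemma measure_survive_inter_le {e : Δ → Set X} (he : ∀ i, MeasurableSet (e i))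
    {G : Set (List Δ → X)} (hG : MeasurableSet G) (n : ℕ) {B : Set (List Δ → X)}
    (hB : MeasurableSet[marksAlgebra X {τ | τ.length < n}] B) :
    treeMeasure Δ ν ({v | (∃ σ : List Δ, σ.length = n ∧ IsAlive e σ v) ∧
      ∀ σ, IsAlive e σ v → subtree σ v ∉ G} ∩ B) ≤ treeMeasure Δ ν Gᶜ * treeMeasure Δ ν B := by
  set μ := treeMeasure Δ ν
  obtain ⟨w, hw⟩ := exists_surjective_nat (List Δ)
  let A : ℕ → Set (List Δ → X) := fun k => {v | (w k).length = n ∧ IsAlive e (w k) v}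
  have hA : ∀ k, MeasurableSet[marksAlgebra X {τ | τ.length < n}] (A k) := by
    intro k
    by_cases hk : (w k).length = n
    · have := measurableSet_isAlive he (w k)
      rw [hk] at this
      simpa [A, hk] using this
    · simp [A, hk]
  -- `disjointed A k` is the event that `w k` is the first alive word of length n.
  have hD : ∀ k, MeasurableSet[marksAlgebra X {τ | τ.length < n}] (disjointed A k) :=
    fun k => @MeasurableSet.disjointed _ (_) _ hA k
  have hsub : {v | (∃ σ : List Δ, σ.length = n ∧ IsAlive e σ v) ∧
      ∀ σ, IsAlive e σ v → subtree σ v ∉ G} ∩ B ⊆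
      ⋃ k, (disjointed A k ∩ B) ∩ subtree (w k) ⁻¹' Gᶜ := by
    rintro v ⟨⟨⟨σ, hσ, hal⟩, hbad⟩, hvB⟩
    obtain ⟨k, rfl⟩ := hw σ
    have : v ∈ ⋃ k, disjointed A k := by
      rw [iUnion_disjointed]
      exact Set.mem_iUnion.2 ⟨k, hσ, hal⟩
    obtain ⟨j, hj⟩ := Set.mem_iUnion.1 this
    exact Set.mem_iUnion.2 ⟨j, ⟨hj, hvB⟩, hbad _ (disjointed_subset A j hj).2⟩
  have hterm : ∀ k, μ ((disjointed A k ∩ B) ∩ subtree (w k) ⁻¹' Gᶜ) ≤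
      μ Gᶜ * μ (disjointed A k ∩ B) := by
    intro k
    by_cases hk : (w k).length = n
    · have hind := indep_marksAlgebra ν (s := {τ : List Δ | τ.length < n})
        (t := {τ | w k <+: τ}) <| by
          rw [Set.disjoint_left]
          intro τ h1 h2
          have := List.IsPrefix.length_le h2
          have h1 : τ.length < n := h1
          omega
      rw [Indep_iff] at hind
      rw [hind _ _ (@MeasurableSet.inter _ (_) _ _ (hD k) hB)
        (measurable_subtree_marksAlgebra (w k) hG.compl), mul_comm,
        (measurePreserving_subtree ν (w k)).measure_preimage hG.compl.nullMeasurableSet]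
    · have : disjointed A k = ∅ :=
        Set.subset_empty_iff.1 fun v hv => hk (disjointed_subset A k hv).1
      simp [this]
  calc _ ≤ μ (⋃ k, (disjointed A k ∩ B) ∩ subtree (w k) ⁻¹' Gᶜ) := measure_mono hsub
    _ ≤ ∑' k, μ ((disjointed A k ∩ B) ∩ subtree (w k) ⁻¹' Gᶜ) := measure_iUnion_le _
    _ ≤ ∑' k, μ Gᶜ * μ (disjointed A k ∩ B) := ENNReal.tsum_le_tsum hterm
    _ = μ Gᶜ * μ (⋃ k, disjointed A k ∩ B) := by
      rw [ENNReal.tsum_mul_left, measure_iUnion]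
      · intro i j hij
        exact ((disjoint_disjointed A hij).mono Set.inter_subset_left Set.inter_subset_left)
      · exact fun k => marksAlgebra_le _ _ (@MeasurableSet.inter _ (_) _ _ (hD k) hB)
    _ ≤ μ Gᶜ * μ B := by
      gcongr
      exact Set.iUnion_subset fun k => Set.inter_subset_right

lemma ae_exists_subtree_mem_of_survive {e : Δ → Set X} (he : ∀ i, MeasurableSet (e i))
    {G : Set (List Δ → X)} (hG : MeasurableSet G) (hG0 : treeMeasure Δ ν G ≠ 0) :
    ∀ᵐ v ∂treeMeasure Δ ν, (∀ n, ∃ σ : List Δ, σ.length = n ∧ IsAlive e σ v) →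
      ∃ σ, IsAlive e σ v ∧ subtree σ v ∈ G := by
  have hal : ∀ σ : List Δ, MeasurableSet {v : List Δ → X | IsAlive e σ v} :=
    fun σ => marksAlgebra_le _ _ (measurableSet_isAlive he σ)
  let E : Set (List Δ → X) := {v | (∀ n, ∃ σ : List Δ, σ.length = n ∧ IsAlive e σ v) ∧
      ∀ σ, IsAlive e σ v → subtree σ v ∉ G}
  have hE : MeasurableSet E := by
    have : E = (⋂ n, ⋃ σ : List Δ, ⋃ _ : σ.length = n, {v | IsAlive e σ v}) ∩
        ⋂ σ : List Δ, ({v | IsAlive e σ v}ᶜ ∪ subtree σ ⁻¹' Gᶜ) := by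
      ext v
      simp [E, imp_iff_not_or]
    rw [this]
    refine (MeasurableSet.iInter fun n => MeasurableSet.iUnion fun σ => MeasurableSet.iUnion
      fun _ => hal σ).inter (MeasurableSet.iInter fun σ => (hal σ).compl.union ?_)
    exact measurable_subtree σ hG.compl
  have hlt : treeMeasure Δ ν Gᶜ < 1 := by
    rw [prob_compl_eq_one_sub hG]
    exact ENNReal.sub_lt_self ENNReal.one_ne_top one_ne_zero hG0
  have hdense := Measure.MeasureDense.of_generateFrom_isSetAlgebra_finite (treeMeasure Δ ν)
    isSetAlgebra_measurableCylinders (generateFrom_measurableCylinders (α := fun _ : List Δ => X)).symm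
  have hcyl : ∀ B ∈ measurableCylinders (fun _ : List Δ => X),
      treeMeasure Δ ν (E ∩ B) ≤ treeMeasure Δ ν Gᶜ * treeMeasure Δ ν B := by
    intro B hB
    obtain ⟨s, T, hT, rfl⟩ := (mem_measurableCylinders B).1 hB
    have hm : MeasurableSet[marksAlgebra X {τ : List Δ | τ.length < s.sup List.length + 1}]
        (cylinder s T) := by
      have : Measurable[marksAlgebra X {τ : List Δ | τ.length < s.sup List.length + 1}]
          (s.restrict (π := fun _ : List Δ => X)) := by
        refine @measurable_pi_lambda _ _ _ (_) _ _ fun τ => measurable_mark ?_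
        exact Nat.lt_succ_of_le (Finset.le_sup (f := List.length) τ.2)
      exact this hT
    refine (measure_mono ?_).trans (measure_survive_inter_le ν he hG _ hm)
    exact Set.inter_subset_inter_left _ fun v hv => ⟨hv.1 _, hv.2⟩
  -- The cylinder estimate passes to B = E by approximation. As μ(Gᶜ) < 1, this forces μ(E) = 0.
  have hle : treeMeasure Δ ν E ≤ treeMeasure Δ ν Gᶜ * treeMeasure Δ ν E := by
    refine ENNReal.le_of_forall_pos_le_add fun ε hε _ => ?_
    obtain ⟨B, hB, hEB⟩ := hdense.approx E hE (measure_ne_top _ _) (ε / 2) (by positivity)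
    have h1 : treeMeasure Δ ν E ≤ treeMeasure Δ ν (E ∩ B) + ENNReal.ofReal (ε / 2) := by
      refine (measure_le_inter_add_sdiff _ E B).trans ?_
      gcongr
      exact (measure_mono Set.subset_union_left).trans hEB.le
    have h2 : treeMeasure Δ ν B ≤ treeMeasure Δ ν E + ENNReal.ofReal (ε / 2) := by
      refine (measure_le_inter_add_sdiff _ B E).trans ?_
      gcongr
      · exact Set.inter_subset_right
      · exact (measure_mono Set.subset_union_right).trans hEB.le
    calc treeMeasure Δ ν E
        ≤ treeMeasure Δ ν Gᶜ * (treeMeasure Δ ν E + ENNReal.ofReal (ε / 2)) +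
            ENNReal.ofReal (ε / 2) := h1.trans (by gcongr; exact (hcyl B hB).trans (by gcongr))
      _ ≤ treeMeasure Δ ν Gᶜ * treeMeasure Δ ν E + 1 * ENNReal.ofReal (ε / 2) +
            ENNReal.ofReal (ε / 2) := by
          rw [mul_add]
          gcongr
      _ = treeMeasure Δ ν Gᶜ * treeMeasure Δ ν E + ε := by
          rw [one_mul, add_assoc, ← ENNReal.ofReal_add (by positivity) (by positivity), add_halves,
            ENNReal.ofReal_coe_nnreal]
  have hE0 : treeMeasure Δ ν E = 0 := by
    by_contra h0
    have := ENNReal.mul_lt_mul_left h0 (measure_ne_top _ _) hlt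
    rw [one_mul] at this
    exact absurd hle (not_le.2 this)
  rw [← compl_mem_ae_iff] at hE0
  filter_upwards [hE0] with v hv hsurv
  by_contra hcon
  push Not at hcon
  exact hv ⟨hsurv, hcon⟩

end Survival

/-! ### Bars in the tree and their weight -/

section Cutset

variable {Δ X : Type*}

/-- The words at which every infinite branch with letters in `F` and edges in `R` meets `C`. -/
inductive IsBar (F : Finset Δ) (R : List Δ → Δ → Prop) (C : Set (List Δ)) : List Δ → Prop
  | mem {σ : List Δ} (h : σ ∈ C) : IsBar F R C σ
  | step {σ : List Δ} (h : ∀ i ∈ F, R σ i → IsBar F R C (σ ++ [i])) : IsBar F R C σ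

variable {F : Finset Δ} {R : List Δ → Δ → Prop} {C : Set (List Δ)}

lemma exists_branch_of_not_isBar {σ : List Δ} (h : ¬ IsBar F R C σ) :
    ∃ ξ : ℕ → List Δ, ξ 0 = σ ∧
      ∀ k, ξ k ∉ C ∧ ∃ i, R (ξ k) i ∧ ξ (k + 1) = ξ k ++ [i] := by
  have hstep : ∀ τ : {τ // ¬ IsBar F R C τ}, ∃ τ' : {τ // ¬ IsBar F R C τ},
      ∃ i, R τ i ∧ (τ' : List Δ) = τ ++ [i] := by
    rintro ⟨τ, hτ⟩
    by_contra hcon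
    push Not at hcon
    refine hτ (.step fun i _ hi => ?_)
    by_contra hb
    exact hcon ⟨_, hb⟩ i hi rfl
  choose f hf using hstep
  refine ⟨fun k => (f^[k] ⟨σ, h⟩ : {τ // ¬ IsBar F R C τ}), rfl, fun k => ⟨?_, ?_⟩⟩
  · exact fun hC => (f^[k] ⟨σ, h⟩).2 (.mem hC)
  · simp only [Function.iterate_succ_apply']
    exact hf _

lemma sum_tsum_indicator_prefix_le (F : Finset Δ) (C : Set (List Δ)) (c : List Δ → ENNReal)
    (σ : List Δ) :
    ∑ i ∈ F, ∑' τ, Set.indicator {τ | τ ∈ C ∧ σ ++ [i] <+: τ} c τ ≤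
      ∑' τ, Set.indicator {τ | τ ∈ C ∧ σ <+: τ} c τ := by
  rw [← Summable.tsum_finsetSum fun i _ => ENNReal.summable]
  refine ENNReal.tsum_le_tsum fun τ => ?_
  by_cases h : ∃ i ∈ F, τ ∈ C ∧ σ ++ [i] <+: τ
  · obtain ⟨i, hi, hτ, hp⟩ := h
    rw [Finset.sum_eq_single_of_mem i hi]
    · rw [Set.indicator_of_mem (s := {τ | τ ∈ C ∧ σ ++ [i] <+: τ}) ⟨hτ, hp⟩,
        Set.indicator_of_mem (s := {τ | τ ∈ C ∧ σ <+: τ})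
          ⟨hτ, (List.prefix_append _ _).trans hp⟩]
    · intro j _ hj
      refine Set.indicator_of_notMem (fun h => hj ?_) _
      have := List.prefix_of_prefix_length_le h.2 hp (by simp)
      simpa using this.eq_of_length (by simp)
  · push Not at h
    rw [Finset.sum_eq_zero]
    · exact zero_le
    · exact fun i hi => Set.indicator_of_notMem (fun hm => h i hi hm.1 hm.2) _

/-- Induction on the bar. Finiteness of F provides a common depth for all children, and the net
content decreases with depth. -/
lemma IsBar.exists_mul_netContent_le {a : Δ → X → ENNReal} {v : List Δ → X} {c : List Δ → ENNReal}
    (hc : ∀ σ i, R σ i → c (σ ++ [i]) = a i (v σ) * c σ) (ha : ∀ σ i, ¬ R σ i → a i (v σ) = 0)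
    {σ : List Δ} (h : IsBar F R C σ) :
    ∃ n, c σ * netContent F a n (subtree σ v) ≤
      ∑' τ, Set.indicator {τ | τ ∈ C ∧ σ <+: τ} c τ := by
  induction h with
  | @mem σ h =>
    refine ⟨0, ?_⟩
    rw [netContent, mul_one]
    refine le_trans ?_ (ENNReal.le_tsum σ)
    rw [Set.indicator_of_mem (s := {τ | τ ∈ C ∧ σ <+: τ}) ⟨h, List.prefix_rfl⟩]
  | @step σ h ih =>
    have : ∀ i, ∃ n, i ∈ F → R σ i → c (σ ++ [i]) * netContent F a n (subtree (σ ++ [i]) v) ≤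
        ∑' τ, Set.indicator {τ | τ ∈ C ∧ σ ++ [i] <+: τ} c τ := by
      intro i
      by_cases hi : i ∈ F ∧ R σ i
      · obtain ⟨n, hn⟩ := ih i hi.1 hi.2
        exact ⟨n, fun _ _ => hn⟩
      · exact ⟨0, fun h1 h2 => absurd ⟨h1, h2⟩ hi⟩
    choose n hn using this
    refine ⟨F.sup n + 1, le_trans ?_ (sum_tsum_indicator_prefix_le F C c σ)⟩
    refine (mul_le_mul_right (min_le_right _ _) _).trans ?_
    rw [Finset.mul_sum]
    refine Finset.sum_le_sum fun i hi => ?_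
    have hroot : subtree σ v [] = v σ := by rw [subtree, List.append_nil]
    have hsub : subtree [i] (subtree σ v) = subtree (σ ++ [i]) v := by
      ext τ
      simp [subtree]
    rw [hroot, hsub]
    by_cases hRi : R σ i
    · refine le_trans ?_ (hn i hi hRi)
      rw [hc σ i hRi, ← mul_assoc, mul_comm (c σ)]
      gcongr
      exact netContent_antitone _ (Finset.le_sup hi)
    · rw [ha σ i hRi, zero_mul, mul_zero]
      exact zero_le

end Cutset

/-- The summable errors η_j enlarge the diameters to positive radii with strict bounds, even for
sets that are empty or single points. -/
lemma exists_cover_of_hausdorffMeasure_eq_zero {X : Type*} [MetricSpace X] [MeasurableSpace X]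
    [BorelSpace X] {s : ℝ} (hs : 0 < s) {K : Set X} (h : μH[s] K = 0) {ε : ENNReal} (hε : ε ≠ 0) :
    ∃ (U : ℕ → Set X) (r : ℕ → ℝ), K ⊆ ⋃ j, U j ∧ (∀ j, 0 < r j) ∧
      (∀ j, ∀ x ∈ U j, ∀ y ∈ U j, dist x y < r j) ∧ ∑' j, ENNReal.ofReal (r j) ^ s ≤ ε := by
  have hε2 : ε / 2 ≠ 0 := (ENNReal.half_pos hε).ne'
  rw [Measure.hausdorffMeasure_apply, ENNReal.iSup_eq_zero] at h
  have h1 := h 1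
  rw [ENNReal.iSup_eq_zero] at h1
  have h2 := (h1 one_pos).trans_lt (pos_iff_ne_zero.2 hε2)
  simp only [iInf_lt_iff] at h2
  obtain ⟨U, hU, hd, hsum⟩ := h2
  obtain ⟨η, hη, hηs⟩ := ENNReal.exists_pos_sum_of_countable hε2 ℕ
  have hfin : ∀ j, Metric.ediam (U j) ≠ ⊤ := fun j => ne_top_of_le_ne_top ENNReal.one_ne_top (hd j)
  have hb : ∀ j, 0 < (Metric.ediam (U j)).toReal ^ s + η j := fun j => by
    have := hη j
    positivity
  refine ⟨U, fun j => ((Metric.ediam (U j)).toReal ^ s + η j) ^ s⁻¹, hU,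
    fun j => Real.rpow_pos_of_pos (hb j) _, fun j x hx y hy => ?_, ?_⟩
  · have h3 : dist x y ≤ (Metric.ediam (U j)).toReal := by
      rw [dist_edist]
      exact ENNReal.toReal_mono (hfin j) (Metric.edist_le_ediam_of_mem hx hy)
    refine h3.trans_lt ?_
    rw [Real.lt_rpow_inv_iff_of_pos ENNReal.toReal_nonneg (hb j).le hs]
    exact lt_add_of_pos_right _ (hη j)
  · calc ∑' j, ENNReal.ofReal (((Metric.ediam (U j)).toReal ^ s + η j) ^ s⁻¹) ^ s
        ≤ ∑' j, ((⨆ _ : (U j).Nonempty, Metric.ediam (U j) ^ s) + η j) := by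
          refine ENNReal.tsum_le_tsum fun j => ?_
          rw [ENNReal.ofReal_rpow_of_pos (Real.rpow_pos_of_pos (hb j) _),
            Real.rpow_inv_rpow (hb j).le hs.ne', ENNReal.ofReal_add (by positivity) (by positivity),
            ENNReal.ofReal_coe_nnreal, ← ENNReal.ofReal_rpow_of_nonneg ENNReal.toReal_nonneg hs.le,
            ENNReal.ofReal_toReal (hfin j)]
          gcongr
          rcases (U j).eq_empty_or_nonempty with he | hne
          · rw [he, Metric.ediam_empty, ENNReal.zero_rpow_of_pos hs]
            exact zero_le
          · exact le_iSup (fun _ : (U j).Nonempty => Metric.ediam (U j) ^ s) hne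
      _ ≤ ε / 2 + ε / 2 := by
          rw [ENNReal.tsum_add]
          exact add_le_add hsum.le hηs.le
      _ = ε := ENNReal.add_halves ε

/-! ### Hausdorff dimension from positive net content -/

section LowerBound

variable {d : ℕ} {Δ Ω : Type*} {J₀ : Compacts (Euc d)} {J : List Δ → Ω → Compacts (Euc d)} {ω : Ω}

/-- The weight `x_i ^ s` of a ratio, cut off outside `[δ, 1 - δ]`. -/
def truncWeight (Δ : Type*) (s δ : ℝ) (i : Δ) (x : Δ → ℝ) : ENNReal :=
  Set.indicator (Set.Icc δ (1 - δ)) (fun y => ENNReal.ofReal y ^ s) (x i)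

/-- Words at which the size first drops to q or below are incomparable: a proper prefix of such a
word is a prefix of its parent, hence has size above q. -/
lemma encard_cutWords_le (hR : IsRegularAt J₀ J ω) {n₀ : ℕ} (hn : CellCountBound J ω n₀)
    {U : Set (Euc d)} {r q : ℝ} (hr : 0 < r) (hU : ∀ x ∈ U, ∀ y ∈ U, dist x y < r) :
    {σ : List Δ | ∃ τ i, σ = τ ++ [i] ∧ q < cellDiam J τ ω ∧ r ≤ cellDiam J σ ω ∧
      cellDiam J σ ω ≤ q ∧ ∃ y ∈ J σ ω, y ∈ U}.encard ≤ n₀ := by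
  rcases U.eq_empty_or_nonempty with rfl | ⟨p, hp⟩
  · simp
  refine hn p r _ hr ?_ (fun σ hσ => ?_) fun σ hσ => ?_
  · rintro σ ⟨-, -, -, -, -, hσq, -⟩ _ ⟨τ, i, rfl, hτq, -⟩ hne hpre
    rcases List.prefix_concat_iff.1 hpre with he | hpre
    · exact hne he
    · exact absurd (hR.cellDiam_le_of_prefix hpre) (not_le.2 (hσq.trans_lt hτq))
  · obtain ⟨-, -, -, -, h, -⟩ := hσ
    exact h
  · obtain ⟨-, -, -, -, -, -, y, hy, hyU⟩ := hσ
    exact ⟨y, hy, hU p hp y hyU⟩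

lemma tsum_indicator_iUnion_le {ι : Type*} (C : ℕ → Set ι) (c : ι → ENNReal) (b : ℕ → ENNReal)
    (n₀ : ℕ) (hcard : ∀ j, (C j).encard ≤ n₀) (hb : ∀ j, ∀ i ∈ C j, c i ≤ b j) :
    ∑' i, Set.indicator (⋃ j, C j) c i ≤ n₀ * ∑' j, b j := by
  calc ∑' i, Set.indicator (⋃ j, C j) c i ≤ ∑' i, ∑' j, Set.indicator (C j) c i := by
        refine ENNReal.tsum_le_tsum fun i => ?_
        by_cases hi : i ∈ ⋃ j, C j
        · obtain ⟨j, hj⟩ := Set.mem_iUnion.1 hi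
          rw [Set.indicator_of_mem hi]
          refine le_trans ?_ (ENNReal.le_tsum j)
          rw [Set.indicator_of_mem hj]
        · rw [Set.indicator_of_notMem hi]
          exact zero_le
    _ = ∑' j, ∑' i, Set.indicator (C j) c i := ENNReal.tsum_comm
    _ ≤ ∑' j, n₀ * b j := by
        refine ENNReal.tsum_le_tsum fun j => ?_
        calc ∑' i, Set.indicator (C j) c i ≤ ∑' i, Set.indicator (C j) (fun _ => b j) i :=
              ENNReal.tsum_le_tsum fun i => Set.indicator_le_indicator' (hb j i)
          _ = (C j).encard * b j := by rw [← tsum_subtype, ENNReal.tsum_set_const]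
          _ ≤ n₀ * b j := by
              gcongr
              simpa using ENat.toENNReal_le.2 (hcard j)
    _ = n₀ * ∑' j, b j := ENNReal.tsum_mul_left

/-- A branch avoiding the cut has cells shrinking to a point of K, which lies in some U_j. Its first
cell of size at most r_j / δ still has size at least r_j, because one step loses at most the factor
δ; so it is in the cut. -/
lemma isBar_cutWords (hR : IsRegularAt J₀ J ω) {v : List Δ → Δ → ℝ}
    (hv : ∀ σ, (J σ ω : Set (Euc d)).Nonempty → v σ = ratioVector J σ ω) {δ : ℝ} (hδ : 0 < δ)
    (F : Finset Δ) {U : ℕ → Set (Euc d)} {r : ℕ → ℝ} (hr : ∀ j, 0 < r j)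
    (hU : limitSet J ω ⊆ ⋃ j, U j) {σ : List Δ} (hσ : (J σ ω : Set (Euc d)).Nonempty)
    (hrσ : ∀ j, r j < δ * cellDiam J σ ω) :
    IsBar F (fun τ i => v τ i ∈ Set.Icc δ (1 - δ))
      (⋃ j, {σ : List Δ | ∃ τ i, σ = τ ++ [i] ∧ r j / δ < cellDiam J τ ω ∧ r j ≤ cellDiam J σ ω ∧
        cellDiam J σ ω ≤ r j / δ ∧ ∃ y ∈ J σ ω, y ∈ U j}) σ := by
  by_contra hbar
  obtain ⟨ξ, h0, hξ⟩ := exists_branch_of_not_isBar hbar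
  have hpos : ∀ k, (J (ξ k) ω : Set (Euc d)).Nonempty ∧
      δ * cellDiam J (ξ k) ω ≤ cellDiam J (ξ (k + 1)) ω ∧
      cellDiam J (ξ (k + 1)) ω ≤ (1 - δ) * cellDiam J (ξ k) ω := by
    have hstep : ∀ k, (J (ξ k) ω : Set (Euc d)).Nonempty →
        δ * cellDiam J (ξ k) ω ≤ cellDiam J (ξ (k + 1)) ω ∧
        cellDiam J (ξ (k + 1)) ω ≤ (1 - δ) * cellDiam J (ξ k) ω := by
      intro k hk
      obtain ⟨-, i, hi, he⟩ := hξ k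
      rw [he, hR.cellDiam_append_singleton hk, ← hv _ hk]
      exact ⟨mul_le_mul_of_nonneg_right hi.1 (cellDiam_nonneg _),
        mul_le_mul_of_nonneg_right hi.2 (cellDiam_nonneg _)⟩
    intro k
    induction k with
    | zero => exact ⟨by rwa [h0], hstep 0 (by rwa [h0])⟩
    | succ k ih =>
      have : (J (ξ (k + 1)) ω : Set (Euc d)).Nonempty := by
        refine nonempty_of_cellDiam_pos (lt_of_lt_of_le ?_ ih.2.1)
        have := hR.cellDiam_pos ih.1
        positivity
      exact ⟨this, hstep _ this⟩
  obtain ⟨y, hy⟩ := IsCompact.nonempty_iInter_of_sequence_nonempty_isCompact_isClosed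
    (fun k => (J (ξ k) ω : Set (Euc d)))
    (fun k => by
      obtain ⟨-, i, -, he⟩ := hξ k
      rw [he]
      exact hR.nested _ _)
    (fun k => (hpos k).1) (J (ξ 0) ω).isCompact (fun k => (J (ξ k) ω).isCompact.isClosed)
  rw [Set.mem_iInter] at hy
  have hlen : ∀ k, (ξ k).length = σ.length + k := by
    intro k
    induction k with
    | zero => rw [h0, add_zero]
    | succ k ih =>
      obtain ⟨-, i, -, he⟩ := hξ k
      rw [he, List.length_append, ih, List.length_singleton, add_assoc]
  have hyK : y ∈ limitSet J ω := by
    refine hR.mem_limitSet.2 fun k => ⟨(ξ k).take k, ?_, ?_⟩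
    · rw [List.length_take, hlen]
      omega
    · exact hR.subset_of_prefix (List.take_prefix _ _) (hy k)
  obtain ⟨j, hj⟩ := Set.mem_iUnion.1 (hU hyK)
  have hδ1 : 0 ≤ 1 - δ := by
    obtain ⟨-, i, hi, -⟩ := hξ 0
    exact hδ.le.trans (hi.1.trans hi.2)
  have hgeom : ∀ k, cellDiam J (ξ k) ω ≤ (1 - δ) ^ k * cellDiam J (ξ 0) ω := by
    intro k
    induction k with
    | zero => simp
    | succ k ih =>
      refine (hpos k).2.2.trans ?_
      rw [pow_succ', mul_assoc]
      exact mul_le_mul_of_nonneg_left ih hδ1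
  have hex : ∃ k, cellDiam J (ξ k) ω ≤ r j / δ := by
    have hlim : Tendsto (fun k => (1 - δ) ^ k * cellDiam J (ξ 0) ω) atTop (𝓝 0) := by
      simpa using (tendsto_pow_atTop_nhds_zero_of_lt_one hδ1 (by linarith)).mul_const
        (cellDiam J (ξ 0) ω)
    obtain ⟨k, hk⟩ := (hlim.eventually_le_const (div_pos (hr j) hδ)).exists
    exact ⟨k, (hgeom k).trans hk⟩
  classical
  -- The starting cell exceeds r_j / δ, so the first small cell has a parent on the branch.
  obtain ⟨k, hk⟩ : ∃ k, Nat.find hex = k + 1 := by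
    refine Nat.exists_eq_succ_of_ne_zero fun hz => ?_
    have := Nat.find_spec hex
    rw [hz, h0, le_div_iff₀ hδ, mul_comm] at this
    exact absurd this (not_le.2 (hrσ j))
  have h1 : cellDiam J (ξ (k + 1)) ω ≤ r j / δ := hk ▸ Nat.find_spec hex
  have h2 : r j / δ < cellDiam J (ξ k) ω := not_le.1 (Nat.find_min hex (by omega))
  obtain ⟨-, i, hi, he⟩ := hξ k
  refine (hξ (k + 1)).1 (Set.mem_iUnion.2 ⟨j, ξ k, i, he, h2, ?_, h1, y, hy _, hj⟩)
  rw [div_lt_iff₀' hδ] at h2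
  exact h2.le.trans (hpos k).2.1

lemma le_dimH_limitSet_of_netContent_pos (hR : IsRegularAt J₀ J ω) {n₀ : ℕ}
    (hn : CellCountBound J ω n₀) {v : List Δ → Δ → ℝ}
    (hv : ∀ σ, (J σ ω : Set (Euc d)).Nonempty → v σ = ratioVector J σ ω) {s δ : ℝ} (hs : 0 < s)
    (hδ : 0 < δ) (F : Finset Δ) {σ : List Δ} (hσ : (J σ ω : Set (Euc d)).Nonempty)
    (hpos : 0 < ⨅ n, netContent F (truncWeight Δ s δ) n (subtree σ v)) :
    ENNReal.ofReal s ≤ dimH (limitSet J ω) := by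
  refine le_dimH_of_hausdorffMeasure_ne_zero (d := s.toNNReal) fun hK => ?_
  rw [Real.coe_toNNReal _ hs.le] at hK
  let c : List Δ → ENNReal := fun τ => ENNReal.ofReal (cellDiam J τ ω) ^ s
  have hlσ := hR.cellDiam_pos hσ
  have hcσ : c σ ≠ 0 := by
    have : 0 < ENNReal.ofReal (cellDiam J σ ω) := ENNReal.ofReal_pos.2 hlσ
    simp only [c]
    positivity
  have hq : ENNReal.ofReal δ⁻¹ ^ s ≠ ⊤ := by finiteness
  -- ε₁ makes the weight n₀ δ^{-s} Σ r_j^s of the cut too small; ε₂ below forces every r_j < δ l_σ.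
  obtain ⟨ε₁, hε₁, hlt₁⟩ := ENNReal.exists_nnreal_pos_mul_lt
    (ENNReal.mul_ne_top (ENNReal.natCast_ne_top n₀) hq) (mul_ne_zero hcσ hpos.ne')
  have hδσ : 0 < δ * cellDiam J σ ω := by positivity
  have hpos2 : (0 : ENNReal) < ENNReal.ofReal (δ * cellDiam J σ ω) ^ s :=
    ENNReal.rpow_pos (ENNReal.ofReal_pos.2 hδσ) ENNReal.ofReal_ne_top
  obtain ⟨ε₂, hε₂, hlt₂⟩ := exists_between hpos2
  obtain ⟨U, r, hU, hr, hdist, hsum⟩ := exists_cover_of_hausdorffMeasure_eq_zero hs hK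
    (ε := min (ε₁ : ENNReal) ε₂) (lt_min (by exact_mod_cast hε₁) hε₂).ne'
  have hrσ : ∀ j, r j < δ * cellDiam J σ ω := by
    intro j
    have h1 := ((ENNReal.le_tsum j).trans (hsum.trans (min_le_right _ _))).trans_lt hlt₂
    exact (ENNReal.ofReal_lt_ofReal_iff hδσ).1 ((ENNReal.rpow_lt_rpow_iff hs).1 h1)
  have hbar := isBar_cutWords hR hv hδ F hr hU hσ hrσ
  obtain ⟨n, hle⟩ := hbar.exists_mul_netContent_le (a := truncWeight Δ s δ) (v := v) (c := c)
    (fun τ i hi => by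
      by_cases hτ : (J τ ω : Set (Euc d)).Nonempty
      · have h1 : 0 ≤ v τ i := hδ.le.trans hi.1
        simp only [c, truncWeight]
        rw [Set.indicator_of_mem hi, hR.cellDiam_append_singleton hτ, ← hv τ hτ,
          ENNReal.ofReal_mul h1, ENNReal.mul_rpow_of_nonneg _ _ hs.le]
      · have h1 : cellDiam J τ ω = 0 := by
          rw [cellDiam, Set.not_nonempty_iff_eq_empty.1 hτ, Metric.diam_empty]
        have h2 : cellDiam J (τ ++ [i]) ω = 0 := le_antisymm
          ((hR.cellDiam_le_of_prefix (List.prefix_append _ _)).trans h1.le) (cellDiam_nonneg _)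
        simp [c, h1, h2, hs])
    (fun τ i hi => Set.indicator_of_notMem hi _)
  refine absurd hle (not_le.2 ?_)
  calc _ ≤ ∑' τ, Set.indicator (⋃ j, {σ : List Δ | ∃ τ i, σ = τ ++ [i] ∧ r j / δ < cellDiam J τ ω ∧
          r j ≤ cellDiam J σ ω ∧ cellDiam J σ ω ≤ r j / δ ∧ ∃ y ∈ J σ ω, y ∈ U j}) c τ :=
        ENNReal.tsum_le_tsum fun τ => Set.indicator_le_indicator_of_subset (fun _ h => h.1)
          (fun _ => zero_le) τ
    _ ≤ n₀ * ∑' j, ENNReal.ofReal (r j / δ) ^ s := by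
        refine tsum_indicator_iUnion_le _ _ _ _
          (fun j => encard_cutWords_le hR hn (hr j) (hdist j)) ?_
        rintro j τ ⟨-, -, -, -, -, h, -⟩
        exact ENNReal.rpow_le_rpow (ENNReal.ofReal_le_ofReal h) hs.le
    _ = (n₀ * ENNReal.ofReal δ⁻¹ ^ s) * ∑' j, ENNReal.ofReal (r j) ^ s := by
        rw [mul_assoc, ← ENNReal.tsum_mul_left (a := ENNReal.ofReal δ⁻¹ ^ s)]
        refine congrArg _ (tsum_congr fun j => ?_)
        rw [div_eq_inv_mul, ENNReal.ofReal_mul (by positivity), ENNReal.mul_rpow_of_nonneg _ _ hs.le]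
    _ ≤ (n₀ * ENNReal.ofReal δ⁻¹ ^ s) * ε₁ := by
        gcongr
        exact hsum.trans (min_le_left _ _)
    _ < c σ * ⨅ n, netContent F (truncWeight Δ s δ) n (subtree σ v) := by
        rwa [mul_comm]
    _ ≤ c σ * netContent F (truncWeight Δ s δ) n (subtree σ v) := by
        gcongr
        exact iInf_le _ _

end LowerBound

/-! ### Covering the limit set by orbits -/

section UpperBound

variable {d : ℕ} {Δ Ω : Type*} [Countable Δ] {J₀ : Compacts (Euc d)}
  {J : List Δ → Ω → Compacts (Euc d)} {S : List Δ → Δ → Ω → Euc d → Euc d}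
  {x : List Δ → Ω → Euc d} {ω : Ω}

lemma encard_iUnion_le_tsum {ι X : Type*} [Countable ι] (C : ι → Set X) :
    (((⋃ i, C i).encard : ℕ∞) : ENNReal) ≤ ∑' i, (((C i).encard : ℕ∞) : ENNReal) := by
  let _ : MeasurableSpace X := ⊤
  simpa [Measure.count_apply] using measure_iUnion_le (μ := Measure.count) C

/-- On the way to y ∈ K, the first cell smaller than r contains both y and an orbit point of its
parent, and that orbit point is r-close to a chosen centre. -/
lemma ballCount_limitSet_le (hR : IsRegularAt J₀ J ω) (hS : IsSimilaritySystem J S)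
    (hx : IsBasePoints J x) {r : ℝ} (hr : 0 < r) (hr1 : r ≤ 1) {k : ℕ}
    (hk : ∀ σ : List Δ, σ.length = k → cellDiam J σ ω < r) :
    ballCount (2 * r) (limitSet J ω) ≤ ∑' τ, Set.indicator {τ | r ≤ cellDiam J τ ω}
      (fun τ => ballCount r (firstOrbit J S τ ω (x τ ω))) τ := by
  rcases eq_top_or_lt_top (∑' τ, Set.indicator {τ | r ≤ cellDiam J τ ω}
      (fun τ => ballCount r (firstOrbit J S τ ω (x τ ω))) τ) with htop | hlt
  · rw [htop]
    exact le_top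
  have hcov : ∀ τ, ∃ C : Finset (Euc d), (r ≤ cellDiam J τ ω →
      ∀ a ∈ firstOrbit J S τ ω (x τ ω), ∃ c ∈ C, dist a c ≤ r) ∧
      Set.indicator {τ | r ≤ cellDiam J τ ω}
        (fun τ => ballCount r (firstOrbit J S τ ω (x τ ω))) τ = (C.card : ENNReal) := by
    intro τ
    by_cases hτ : r ≤ cellDiam J τ ω
    · have h1 := (ENNReal.le_tsum τ).trans_lt hlt
      rw [Set.indicator_of_mem (s := {τ | r ≤ cellDiam J τ ω}) hτ] at h1 ⊢
      obtain ⟨C, hC, hcard⟩ := exists_cover_of_ballCount_lt_top hr.le h1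
      exact ⟨C, fun _ => hC, hcard⟩
    · exact ⟨∅, fun h => absurd h hτ, by
        rw [Set.indicator_of_notMem (s := {τ | r ≤ cellDiam J τ ω}) hτ]; simp⟩
  choose C hC hcard using hcov
  refine (ballCount_le_encard (⋃ τ, (C τ : Set (Euc d))) ?_).trans ?_
  · intro y hy
    obtain ⟨σ, hσ, hyσ⟩ := hR.mem_limitSet.1 hy k
    have hex : ∃ m, cellDiam J (σ.take m) ω < r := ⟨k, by
      rw [← hσ, List.take_length]
      exact hk σ hσ⟩
    classical
    obtain ⟨m, hm⟩ : ∃ m, Nat.find hex = m + 1 := by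
      refine Nat.exists_eq_succ_of_ne_zero fun hz => ?_
      have := Nat.find_spec hex
      rw [hz, List.take_zero, hR.cellDiam_nil] at this
      exact absurd this (not_lt.2 hr1)
    have h1 : cellDiam J (σ.take (m + 1)) ω < r := hm ▸ Nat.find_spec hex
    have h2 : r ≤ cellDiam J (σ.take m) ω := not_lt.1 (Nat.find_min hex (by omega))
    have hlen : m < σ.length := by
      by_contra hle
      rw [List.take_of_length_le (by omega)] at h1 h2
      exact absurd h1 (not_lt.2 h2)
    have htake : σ.take (m + 1) = σ.take m ++ [σ[m]] := (List.take_append_getElem hlen).symm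
    have hymem := hR.subset_of_prefix (List.take_prefix (m + 1) σ) hyσ
    rw [htake] at h1 hymem
    have hne : (J (σ.take m) ω : Set (Euc d)).Nonempty := ⟨y, hR.nested _ _ hymem⟩
    obtain ⟨c, hc, hdc⟩ := hC _ h2 (S (σ.take m) σ[m] ω (x (σ.take m) ω)) ⟨_, ⟨y, hymem, hy⟩, rfl⟩
    refine ⟨c, Set.mem_iUnion.2 ⟨_, hc⟩, ?_⟩
    have h3 := dist_le_cellDiam hymem (hS.map_mem (hx _ ω hne) ⟨y, hymem⟩)
    have h4 := dist_triangle y (S (σ.take m) σ[m] ω (x (σ.take m) ω)) c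
    linarith
  · refine (encard_iUnion_le_tsum _).trans (ENNReal.tsum_le_tsum fun τ => ?_)
    rw [hcard, Set.encard_coe_eq_coe_finsetCard]
    simp

lemma upperMinkowskiDim_limitSet_le (hR : IsRegularAt J₀ J ω) (hS : IsSimilaritySystem J S)
    (hx : IsBasePoints J x) {t A : ℝ} (ht : 0 < t) (hA : 0 < A)
    (hsum : ∑' σ, ENNReal.ofReal (cellDiam J σ ω) ^ t < ⊤)
    (hbound : ∀ τ r, 0 < r → r ≤ cellDiam J τ ω → ballCount r (firstOrbit J S τ ω (x τ ω)) ≤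
      ENNReal.ofReal (A * r ^ (-t) * cellDiam J τ ω ^ t)) :
    upperMinkowskiDim (limitSet J ω) ≤ t := by
  refine upperMinkowskiDim_le_of_ballCount_le (c := 2) two_pos
    (C := ENNReal.ofReal A * ∑' σ, ENNReal.ofReal (cellDiam J σ ω) ^ t)
    (ENNReal.mul_ne_top ENNReal.ofReal_ne_top hsum.ne) ?_
  filter_upwards [eventually_mem_Ioo] with r hr
  obtain ⟨hr, hr1⟩ := hr
  -- A convergent sum leaves only finitely many cells of size at least r, so their lengths are
  -- bounded.
  obtain ⟨k, hk⟩ : ∃ k, ∀ σ : List Δ, σ.length = k → cellDiam J σ ω < r := by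
    have hpos : ENNReal.ofReal r ^ t ≠ 0 :=
      (ENNReal.rpow_pos (ENNReal.ofReal_pos.2 hr) ENNReal.ofReal_ne_top).ne'
    have hfin := ENNReal.finite_const_le_of_tsum_ne_top hsum.ne hpos
    refine ⟨hfin.toFinset.sup List.length + 1, fun σ hσ => ?_⟩
    by_contra hge
    have hmem : σ ∈ hfin.toFinset := by
      rw [Set.Finite.mem_toFinset]
      exact ENNReal.rpow_le_rpow (ENNReal.ofReal_le_ofReal (not_lt.1 hge)) ht.le
    have := Finset.le_sup (f := List.length) hmem
    omega
  refine (ballCount_limitSet_le hR hS hx hr hr1.le hk).trans ?_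
  rw [mul_right_comm, ← ENNReal.tsum_mul_left]
  refine ENNReal.tsum_le_tsum fun τ => ?_
  by_cases hτ : r ≤ cellDiam J τ ω
  · rw [Set.indicator_of_mem (s := {τ | r ≤ cellDiam J τ ω}) hτ]
    refine (hbound τ r hr hτ).trans (le_of_eq ?_)
    rw [ENNReal.ofReal_mul (by positivity), ENNReal.ofReal_mul hA.le,
      ENNReal.ofReal_rpow_of_nonneg (cellDiam_nonneg _) ht.le]
  · rw [Set.indicator_of_notMem (s := {τ | r ≤ cellDiam J τ ω}) hτ]
    exact zero_le

end UpperBound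

/-! ### The moment function of the ratio vector -/

section Moments

variable {Δ : Type*} {ν : Measure (Δ → ℝ)}

lemma measurable_truncWeight (s δ : ℝ) (i : Δ) : Measurable (truncWeight Δ s δ i) := by
  have : Measurable (Set.indicator (Set.Icc δ (1 - δ)) fun y : ℝ => ENNReal.ofReal y ^ s) :=
    Measurable.indicator (by fun_prop) measurableSet_Icc
  exact this.comp (measurable_pi_apply i)

lemma truncWeight_le_one {s δ : ℝ} (hs : 0 ≤ s) (hδ : 0 ≤ δ) (i : Δ) (x : Δ → ℝ) :
    truncWeight Δ s δ i x ≤ 1 := by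
  refine Set.indicator_apply_le' (fun hy => ?_) (fun _ => zero_le)
  refine ENNReal.rpow_le_one ?_ hs
  rw [ENNReal.ofReal_le_one]
  linarith [hy.2]

lemma tendsto_lintegral_truncWeight (hν : ∀ᵐ x ∂ν, ∀ i, 0 ≤ x i ∧ x i < 1) {s : ℝ} (hs : 0 < s)
    (i : Δ) :
    Tendsto (fun n : ℕ => ∫⁻ x, truncWeight Δ s (1 / (n + 1)) i x ∂ν) atTop
      (𝓝 (∫⁻ x, ENNReal.ofReal (x i) ^ s ∂ν)) := by
  refine lintegral_tendsto_of_tendsto_of_monotone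
    (fun n => (measurable_truncWeight _ _ _).aemeasurable) (Eventually.of_forall fun x => ?_) ?_
  · intro m n hmn
    have : (1 : ℝ) / (n + 1) ≤ 1 / (m + 1) := Nat.one_div_le_one_div hmn
    exact Set.indicator_le_indicator_of_subset (Set.Icc_subset_Icc this (by linarith))
      (fun _ => zero_le) _
  · filter_upwards [hν] with x hx
    rcases (hx i).1.eq_or_lt with h0 | h0
    · refine tendsto_const_nhds.congr fun n => ?_
      have : (0 : ℝ) < 1 / (n + 1) := Nat.one_div_pos_of_nat
      rw [truncWeight, ← h0, Set.indicator_of_notMem (fun h => absurd h.1 (not_le.2 this)),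
        ENNReal.ofReal_zero, ENNReal.zero_rpow_of_pos hs]
    · refine tendsto_const_nhds.congr' ?_
      have hlim := tendsto_one_div_add_atTop_nhds_zero_nat (𝕜 := ℝ)
      filter_upwards [hlim.eventually_le_const h0,
        hlim.eventually_le_const (sub_pos.2 (hx i).2)] with n h1 h2
      rw [truncWeight, Set.indicator_of_mem (s := Set.Icc _ _) ⟨h1, by linarith⟩]

lemma exists_one_lt_sum_truncWeight (hν : ∀ᵐ x ∂ν, ∀ i, 0 ≤ x i ∧ x i < 1) {s : ℝ} (hs : 0 < s)
    (h : 1 < ∑' i, ∫⁻ x, ENNReal.ofReal (x i) ^ s ∂ν) :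
    ∃ (F : Finset Δ) (δ : ℝ), 0 < δ ∧ 1 < ∑ i ∈ F, ∫⁻ x, truncWeight Δ s δ i x ∂ν := by
  rw [ENNReal.tsum_eq_iSup_sum, lt_iSup_iff] at h
  obtain ⟨F, hF⟩ := h
  have hlim := tendsto_finsetSum F fun i _ => tendsto_lintegral_truncWeight hν hs i
  obtain ⟨n, hn⟩ := (hlim.eventually_const_lt hF).exists
  exact ⟨F, 1 / (n + 1), Nat.one_div_pos_of_nat, hn⟩

/-- Ratios below 1 make the powers strictly decreasing in the exponent. Equality would make all
ratios vanish a.s., and then the sum is 0. -/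
lemma tsum_lintegral_rpow_lt_one [Countable Δ] (hν : ∀ᵐ x ∂ν, ∀ i, 0 ≤ x i ∧ x i < 1) {s t : ℝ}
    (hs : 0 < s) (hst : s < t) (h : ∑' i, ∫⁻ x, ENNReal.ofReal (x i) ^ s ∂ν ≤ 1) :
    ∑' i, ∫⁻ x, ENNReal.ofReal (x i) ^ t ∂ν < 1 := by
  have hm : ∀ (u : ℝ) (i : Δ), Measurable fun x : Δ → ℝ => ENNReal.ofReal (x i) ^ u :=
    fun u i => by fun_prop
  have hswap : ∀ u : ℝ, ∑' i, ∫⁻ x, ENNReal.ofReal (x i) ^ u ∂ν =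
      ∫⁻ x, ∑' i, ENNReal.ofReal (x i) ^ u ∂ν :=
    fun u => (lintegral_tsum fun i => (hm u i).aemeasurable).symm
  rw [hswap] at h ⊢
  have hle : ∀ᵐ x ∂ν, ∀ i, ENNReal.ofReal (x i) ^ t ≤ ENNReal.ofReal (x i) ^ s := by
    filter_upwards [hν] with x hx i
    exact ENNReal.rpow_le_rpow_of_exponent_ge
      (ENNReal.ofReal_le_one.2 (hx i).2.le) hst.le
  have hle2 : (fun x => ∑' i, ENNReal.ofReal (x i) ^ t) ≤ᵐ[ν]
      fun x => ∑' i, ENNReal.ofReal (x i) ^ s := by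
    filter_upwards [hle] with x hx
    exact ENNReal.tsum_le_tsum hx
  refine ((lintegral_mono_ae hle2).trans h).lt_of_ne fun heq => ?_
  have hae := ae_eq_of_ae_le_of_lintegral_le hle2 (by rw [heq]; exact ENNReal.one_ne_top)
    (Measurable.tsum fun i => hm s i).aemeasurable (by rw [heq]; exact h)
  have hfin : ∀ᵐ x ∂ν, ∑' i, ENNReal.ofReal (x i) ^ t < ⊤ :=
    ae_lt_top (Measurable.tsum fun i => hm t i) (by rw [heq]; exact ENNReal.one_ne_top)
  have hzero : ∀ᵐ x ∂ν, ∑' i, ENNReal.ofReal (x i) ^ t = 0 := by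
    filter_upwards [hν, hae, hfin, hle] with x hx he hf hl
    rw [ENNReal.tsum_eq_zero]
    intro i
    by_contra hne
    have hpos : 0 < x i := by
      by_contra hle0
      rw [ENNReal.ofReal_of_nonpos (not_lt.1 hle0), ENNReal.zero_rpow_of_pos (hs.trans hst)] at hne
      exact hne rfl
    have hlt : ENNReal.ofReal (x i) ^ t < ENNReal.ofReal (x i) ^ s :=
      ENNReal.rpow_lt_rpow_of_exponent_gt (ENNReal.ofReal_pos.2 hpos)
        (ENNReal.ofReal_lt_one.2 (hx i).2) hst
    exact absurd he (ENNReal.tsum_lt_tsum hf.ne hl hlt).ne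
  rw [lintegral_congr_ae hzero, lintegral_zero] at heq
  exact zero_ne_one heq

end Moments

/-! ### Almost sure statements for the construction -/

section AlmostSure

variable {d : ℕ} {Δ Ω : Type*} [Countable Δ] [MeasurableSpace Ω] {P : Measure Ω}
  {J₀ : Compacts (Euc d)} {J : List Δ → Ω → Compacts (Euc d)}

lemma IsRandomRecursiveConstruction.ae_isRegularAt (hJ : IsRandomRecursiveConstruction P J₀ J) :
    ∀ᵐ ω ∂P, IsRegularAt J₀ J ω := by
  have hdisj : ∀ᵐ ω ∂P, ∀ σ τ : List Δ, σ.length = τ.length → σ ≠ τ →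
      interior (J σ ω : Set (Euc d)) ∩ interior (J τ ω : Set (Euc d)) = ∅ := by
    simp only [ae_all_iff]
    exact hJ.open_set
  filter_upwards [hJ.root, hJ.nested, hdisj] with ω h1 h2 h3
  refine ⟨hJ.seed_diam, h1, fun σ => hJ.similar σ ω, fun σ i => (h2 σ i).1, fun i => ?_, h3⟩
  rw [← h1]
  refine (h2 [] i).2 (nonempty_of_cellDiam_pos ?_)
  rw [cellDiam, h1, hJ.seed_diam]
  exact one_pos

omit [Countable Δ] [MeasurableSpace Ω] in
lemma IsRegularAt.isAlive_iff {ω : Ω} (hR : IsRegularAt J₀ J ω) {v : List Δ → Δ → ℝ}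
    (hv : ∀ σ, (J σ ω : Set (Euc d)).Nonempty → v σ = ratioVector J σ ω) (σ : List Δ) :
    IsAlive (fun i => {x : Δ → ℝ | 0 < x i}) σ v ↔ (J σ ω : Set (Euc d)).Nonempty := by
  induction σ using List.reverseRecOn with
  | nil => exact iff_of_true (fun τ i h => by simp at h) hR.nonempty_nil
  | append_singleton σ i ih =>
    rw [isAlive_append_singleton, ih]
    constructor
    · rintro ⟨h1, h2⟩
      refine nonempty_of_cellDiam_pos ?_
      rw [hR.cellDiam_append_singleton h1, ← hv σ h1]
      exact mul_pos h2 (hR.cellDiam_pos h1)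
    · intro h
      have h1 := h.mono (hR.nested σ i)
      refine ⟨h1, ?_⟩
      change 0 < v σ i
      rw [hv σ h1]
      exact div_pos (hR.cellDiam_pos h) (hR.cellDiam_pos h1)

omit [Countable Δ] [MeasurableSpace Ω] in
-- Only an inequality: below an empty cell the size is 0 while the auxiliary marks are arbitrary.
lemma IsRegularAt.cellDiam_rpow_le_wordWeight {ω : Ω} (hR : IsRegularAt J₀ J ω)
    {v : List Δ → Δ → ℝ} (hv : ∀ σ, (J σ ω : Set (Euc d)).Nonempty → v σ = ratioVector J σ ω)
    {t : ℝ} (ht : 0 < t) (σ : List Δ) :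
    ENNReal.ofReal (cellDiam J σ ω) ^ t ≤
      wordWeight (fun i (x : Δ → ℝ) => ENNReal.ofReal (x i) ^ t) σ v := by
  induction σ using List.reverseRecOn with
  | nil => simp [wordWeight, hR.cellDiam_nil]
  | append_singleton σ i ih =>
    rw [wordWeight_append_singleton]
    by_cases h : (J σ ω : Set (Euc d)).Nonempty
    · rw [hR.cellDiam_append_singleton h, hv σ h, ENNReal.ofReal_mul (hR.ratioVector_mem i).1,
        ENNReal.mul_rpow_of_nonneg _ _ ht.le, mul_comm]
      gcongr
    · have h1 : ¬ (J (σ ++ [i]) ω : Set (Euc d)).Nonempty := fun h' => h (h'.mono (hR.nested σ i))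
      rw [cellDiam, Set.not_nonempty_iff_eq_empty.1 h1, Metric.diam_empty, ENNReal.ofReal_zero,
        ENNReal.zero_rpow_of_pos ht]
      exact zero_le

variable [IsProbabilityMeasure P]

/-- Almost surely, if the limit set is nonempty and of dimension less than `t`, the sizes of
the cells have a finite `t`-th moment sum. -/
lemma IsRandomRecursiveConstruction.ae_tsum_cellDiam_lt_top
    (hJ : IsRandomRecursiveConstruction P J₀ J) {n₀ : ℕ}
    (hn : ∀ ω, IsRegularAt J₀ J ω → CellCountBound J ω n₀) :
    ∀ᵐ ω ∂P, (limitSet J ω).Nonempty → ∀ q : ℚ, 0 < q →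
      dimH (limitSet J ω) < ENNReal.ofReal q →
      ∑' σ, ENNReal.ofReal (cellDiam J σ ω) ^ (q : ℝ) < ⊤ := by
  obtain ⟨Q, V, hQ, hVm, hVi, hVd, hVr⟩ := hJ.iid_ratios
  have hreg : ∀ᵐ z ∂P.prod Q, IsRegularAt J₀ J z.1 :=
    Measure.quasiMeasurePreserving_fst.ae hJ.ae_isRegularAt
  have : IsProbabilityMeasure ((P.prod Q).map (V [])) :=
    Measure.isProbabilityMeasure_map (hVm []).aemeasurable
  set ν := (P.prod Q).map (V []) with hνdef
  have hVmeas : Measurable fun z σ => V σ z := measurable_pi_lambda _ hVm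
  have hlaw : (P.prod Q).map (fun z σ => V σ z) = treeMeasure Δ ν := by
    rw [hVi.map_fun_eq_infinitePi_map hVm]
    congr 1
    ext1 σ
    exact (hVd σ).map_eq
  have hν : ∀ᵐ x ∂ν, ∀ i, 0 ≤ x i ∧ x i < 1 := by
    rw [hνdef, ae_map_iff (hVm []).aemeasurable]
    · filter_upwards [hreg, hVr] with z h1 h2 i
      rw [h2 [] h1.nonempty_nil]
      exact ⟨(h1.ratioVector_mem i).1, h1.ratioVector_nil_lt_one i⟩
    · have : {x : Δ → ℝ | ∀ i, 0 ≤ x i ∧ x i < 1} = ⋂ i, (fun x : Δ → ℝ => x i) ⁻¹' Set.Ico 0 1 := by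
        ext x
        simp
      rw [this]
      exact MeasurableSet.iInter fun i => measurable_pi_apply i measurableSet_Ico
  have hlow : ∀ t : ℝ, 0 < t → 1 < ∑' i, ∫⁻ x, ENNReal.ofReal (x i) ^ t ∂ν →
      ∀ᵐ z ∂P.prod Q, (limitSet J z.1).Nonempty → ENNReal.ofReal t ≤ dimH (limitSet J z.1) := by
    intro t ht hφ
    obtain ⟨F, δ, hδ, hsum⟩ := exists_one_lt_sum_truncWeight hν ht hφ
    have hm := measurable_truncWeight (Δ := Δ) t δ
    have hG : MeasurableSet {v | 0 < ⨅ n, netContent F (truncWeight Δ t δ) n v} :=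
      measurableSet_lt measurable_const (Measurable.iInf fun n => measurable_netContent hm n)
    have hpos := measure_iInf_netContent_pos ν hm (truncWeight_le_one ht.le hδ.le) hsum
    have hsurv := ae_exists_subtree_mem_of_survive ν (e := fun i => {x : Δ → ℝ | 0 < x i})
      (fun i => measurableSet_lt measurable_const (measurable_pi_apply i)) hG hpos
    rw [← hlaw] at hsurv
    filter_upwards [ae_of_ae_map hVmeas.aemeasurable hsurv, hreg, hVr] with z h1 h2 h3 hK
    obtain ⟨y, hy⟩ := hK
    obtain ⟨σ, hσ, hσG⟩ := h1 fun k => by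
      obtain ⟨σ, hσ, hyσ⟩ := h2.mem_limitSet.1 hy k
      exact ⟨σ, hσ, (h2.isAlive_iff h3 σ).2 ⟨y, hyσ⟩⟩
    exact le_dimH_limitSet_of_netContent_pos h2 (hn _ h2) h3 ht hδ F
      ((h2.isAlive_iff h3 σ).1 hσ) hσG
  have hprod : ∀ᵐ z ∂P.prod Q, (limitSet J z.1).Nonempty → ∀ q : ℚ, 0 < q →
      dimH (limitSet J z.1) < ENNReal.ofReal q →
      ∑' σ, ENNReal.ofReal (cellDiam J σ z.1) ^ (q : ℝ) < ⊤ := by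
    have hq : ∀ q : ℚ, ∀ᵐ z ∂P.prod Q, (limitSet J z.1).Nonempty → 0 < q →
        dimH (limitSet J z.1) < ENNReal.ofReal q →
        ∑' σ, ENNReal.ofReal (cellDiam J σ z.1) ^ (q : ℝ) < ⊤ := by
      intro q
      by_cases hq0 : 0 < q
      swap
      · exact Eventually.of_forall fun z _ h => absurd h hq0
      have hq0' : (0 : ℝ) < q := by exact_mod_cast hq0
      -- Below 1 the expected sum converges. Otherwise the moment exceeds 1 at every smaller
      -- positive exponent, so dim_H K < q is a.s. impossible on K ≠ ∅.
      by_cases hφ : ∑' i, ∫⁻ x, ENNReal.ofReal (x i) ^ (q : ℝ) ∂ν < 1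
      · have hfin := ae_tsum_wordWeight_lt_top ν
          (b := fun i (x : Δ → ℝ) => ENNReal.ofReal (x i) ^ (q : ℝ)) (fun i => by fun_prop) hφ
        rw [← hlaw] at hfin
        filter_upwards [ae_of_ae_map hVmeas.aemeasurable hfin, hreg, hVr] with z h1 h2 h3 _ _ _
        exact (ENNReal.tsum_le_tsum (h2.cellDiam_rpow_le_wordWeight h3 hq0')).trans_lt h1
      · have hall : ∀ᵐ z ∂P.prod Q, ∀ p : ℚ, 0 < p → p < q → (limitSet J z.1).Nonempty →
            ENNReal.ofReal p ≤ dimH (limitSet J z.1) := by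
          rw [ae_all_iff]
          intro p
          by_cases hp : 0 < p ∧ p < q
          · have hp0 : (0 : ℝ) < p := by exact_mod_cast hp.1
            have hpq : (p : ℝ) < q := by exact_mod_cast hp.2
            filter_upwards [hlow p hp0 (by
              by_contra hle
              exact hφ (tsum_lintegral_rpow_lt_one hν hp0 hpq (not_lt.1 hle)))] with z hz _ _
            exact hz
          · exact Eventually.of_forall fun z h1 h2 => absurd ⟨h1, h2⟩ hp
        filter_upwards [hall] with z hz hK _ hlt
        obtain ⟨p, hp0, hp1, hp2⟩ := ENNReal.lt_iff_exists_rat_btwn.1 hlt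
        have hpq : p < q := by
          have := (ENNReal.ofReal_lt_ofReal_iff hq0').1 hp2
          exact_mod_cast this
        have hpos : 0 < p := by
          have : (0 : ℝ) < p := ENNReal.ofReal_pos.1 (zero_le.trans_lt hp1)
          exact_mod_cast this
        exact absurd (hz p hpos hpq hK) (not_le.2 hp1)
    filter_upwards [ae_all_iff.2 hq] with z hz hK q
    exact hz q hK
  -- The claim does not involve the auxiliary factor, so one point of almost every fibre suffices.
  filter_upwards [Measure.ae_ae_of_ae_prod hprod] with ω hω
  exact hω.exists.choose_spec

lemma ae_upperMinkowskiDim_limitSet_le (hJ : IsRandomRecursiveConstruction P J₀ J) {n₀ : ℕ}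
    (hn : ∀ ω, IsRegularAt J₀ J ω → CellCountBound J ω n₀)
    {S : List Δ → Δ → Ω → Euc d → Euc d} (hS : IsSimilaritySystem J S)
    {x : List Δ → Ω → Euc d} (hx : IsBasePoints J x) {D : Set (Euc d) → EReal}
    (hD : UniformOrbitBound P D J S x) :
    ∀ᵐ ω ∂P, (limitSet J ω).Nonempty → upperMinkowskiDim (limitSet J ω) ≤
      max (dimH (limitSet J ω) : EReal) (orbitDimSup D J S x ω) := by
  obtain ⟨A, hA, hbound⟩ := hD
  filter_upwards [hJ.ae_isRegularAt, hJ.ae_tsum_cellDiam_lt_top hn, hbound] with ω hR hsum hb hK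
  refine EReal.le_of_forall_lt_iff_le.1 fun t ht => ?_
  -- A rational exponent, since the exceptional null set is controlled for countably many exponents
  -- only.
  obtain ⟨q, hq1, hq2⟩ := EReal.lt_iff_exists_rat_btwn.1 ht
  obtain ⟨hdim, hsup⟩ := max_lt_iff.1 hq1
  have hq0 : (0 : ℝ) < q := by
    have h0 : (0 : EReal) ≤ dimH (limitSet J ω) := EReal.coe_ennreal_nonneg _
    exact_mod_cast h0.trans_lt hdim
  have hdim' : dimH (limitSet J ω) < ENNReal.ofReal q := by
    rw [← EReal.coe_ennreal_lt_coe_ennreal_iff, EReal.coe_ennreal_ofReal, max_eq_left hq0.le]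
    exact hdim
  refine le_trans ?_ hq2.le
  refine upperMinkowskiDim_limitSet_le hR hS hx hq0 hA (hsum hK q (by exact_mod_cast hq0) hdim') ?_
  intro τ r hr hrτ
  have hτ : (J τ ω : Set (Euc d)).Nonempty := nonempty_of_cellDiam_pos (hr.trans_le hrτ)
  refine hb τ _ (hx τ ω hτ) q hq0 (lt_of_le_of_lt ?_ hsup) r hr hrτ
  exact le_iSup₂ (f := fun τ (_ : (J τ ω : Set (Euc d)).Nonempty) =>
    D (firstOrbit J S τ ω (x τ ω))) τ hτ

omit [Countable Δ] [MeasurableSpace Ω] in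
lemma orbitDimSup_le_of_comparison {ω : Ω} {n₀ : ℕ} (hn : CellCountBound J ω n₀)
    {S : List Δ → Δ → Ω → Euc d → Euc d} (hS : IsSimilaritySystem J S)
    {x : List Δ → Ω → Euc d} (hx : IsBasePoints J x) {D : Set (Euc d) → EReal}
    (hD : ∀ (A B : Set (Euc d)) (c : ℝ) (C : ENNReal), 0 < c → C ≠ ⊤ →
      (∀ᶠ r in 𝓝[>] (0 : ℝ), ballCount (c * r) A ≤ C * ballCount r B) → D A ≤ D B) :
    orbitDimSup D J S x ω ≤ D (limitSet J ω) := by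
  refine iSup₂_le fun τ hτ => hD _ _ 3 (n₀ + 1) (by norm_num) (by finiteness) ?_
  filter_upwards [self_mem_nhdsWithin] with r hr
  exact ballCount_firstOrbit_le hS hn (hx τ ω hτ) hr

end AlmostSure

end RandomRecursive

end

open RandomRecursive in
theorem mainTheorem1 {d : ℕ} {Δ Ω : Type*} [Countable Δ] [MeasurableSpace Ω]
    (P : Measure Ω) [IsProbabilityMeasure P]
    (J₀ : Compacts (Euc d)) (J : List Δ → Ω → Compacts (Euc d))
    (hJ : IsRandomRecursiveConstruction P J₀ J)
    (hfin : PointwiseFinite P J₀ J)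
    (hnbd : NeighborhoodBounded (J₀ : Set (Euc d)))
    (S : List Δ → Δ → Ω → Euc d → Euc d) (hS : IsSimilaritySystem J S)
    (x : List Δ → Ω → Euc d) (hx : IsBasePoints J x) :
    (UniformOrbitBound P upperMinkowskiDim J S x →
      ∀ᵐ ω ∂P, (limitSet J ω).Nonempty →
        upperMinkowskiDim (limitSet J ω) =
          max (dimH (limitSet J ω) : EReal) (orbitDimSup upperMinkowskiDim J S x ω)) ∧
    (UniformOrbitBound P lowerMinkowskiDim J S x →
      ∀ᵐ ω ∂P, (limitSet J ω).Nonempty →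
        upperMinkowskiDim (limitSet J ω) =
          max (dimH (limitSet J ω) : EReal) (orbitDimSup lowerMinkowskiDim J S x ω) ∧
        lowerMinkowskiDim (limitSet J ω) =
          max (dimH (limitSet J ω) : EReal) (orbitDimSup lowerMinkowskiDim J S x ω)) := by
  obtain ⟨n₀, hn⟩ := exists_cellCountBound hnbd hJ.seed_diam J
  have hupper {ω : Ω} (hR : IsRegularAt J₀ J ω) :
      orbitDimSup upperMinkowskiDim J S x ω ≤ upperMinkowskiDim (limitSet J ω) :=
    orbitDimSup_le_of_comparison (hn ω hR) hS hx
      fun _ _ _ _ hc hC h => upperMinkowskiDim_le_of_comparison hc hC h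
  have hlower {ω : Ω} (hR : IsRegularAt J₀ J ω) :
      orbitDimSup lowerMinkowskiDim J S x ω ≤ lowerMinkowskiDim (limitSet J ω) :=
    orbitDimSup_le_of_comparison (hn ω hR) hS hx
      fun _ _ _ _ hc hC h => lowerMinkowskiDim_le_of_comparison hc hC h
  refine ⟨fun hD => ?_, fun hD => ?_⟩
  · filter_upwards [hJ.ae_isRegularAt, ae_upperMinkowskiDim_limitSet_le hJ hn hS hx hD]
      with ω hR hle hK
    exact (hle hK).antisymm (max_le ((dimH_le_lowerMinkowskiDim hK).trans
      (lowerMinkowskiDim_le_upperMinkowskiDim _)) (hupper hR))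
  · filter_upwards [hJ.ae_isRegularAt, ae_upperMinkowskiDim_limitSet_le hJ hn hS hx hD]
      with ω hR hle hK
    have hge : max (dimH (limitSet J ω) : EReal) (orbitDimSup lowerMinkowskiDim J S x ω) ≤
        lowerMinkowskiDim (limitSet J ω) := max_le (dimH_le_lowerMinkowskiDim hK) (hlower hR)
    have hlu := lowerMinkowskiDim_le_upperMinkowskiDim (limitSet J ω)
    exact ⟨(hle hK).antisymm (hge.trans hlu), (hlu.trans (hle hK)).antisymm hge⟩
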